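/- Let $t\in[0,1)$, let $a_1,a_2,\dots\in(0,1)$, and let $n\ge 0$. **Hall–Littlewood side.** For a partition $\lambda$ with at most $m$ non-zero parts let $$P_\lambda(x_1,\dots,x_m)=\prod_{j\ge0}\frac1{v_{m_j}(t)}\sum_{\sigma\in S_m}\sigma\Big(x_1^{\lambda_1}\cdots x_m^{\lambda_m}\prod_{i<j}\frac{x_i-tx_j}{x_i-x_j}\Big),\qquad v_k(t)=\prod_{r=1}^k\frac{1-t^r}{1-t},$$ where $m_j=\#\{i\le m:\lambda_i=j\}$, be the Hall–Littlewood polynomial ($P_\lambda(x_1,\dots,x_m)=0$ if $\lambda$ has more than $m$ non-zero parts), and let the one-variable skew functions $P_{\lambda/\mu}(z)$ be the coefficients determined by $P_\lambda(z,x_1,\dots,x_N)=\sum_\mu P_{\lambda/\mu}(z)P_\mu(x_1,\dots,x_N)$ for all $N$. Let $\ell(\lambda)$ be the number of non-zero parts of $\lambda$, let $\Phi(a_1,\dots,a_n)=\prod_{1\le i<j\le n}\frac{1-ta_ia_j}{1-a_ia_j}$, and let $b^{\mathrm{el}}_\lambda=\prod_{\square}\frac{1-q^{a(\square)}t^{\ell(\square)+1}}{1-q^{a(\square)+1}t^{\ell(\square)}}\Big|_{q=0}$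 (with $0^0=1$), the product running over the boxes of $\lambda$ with even leg length $\ell(\square)$ (number of boxes below $\square$), where $a(\square)$ is the arm length (number of boxes to the right of $\square$). The ascending half-space Hall–Littlewood process is the measure on sequences $(\lambda^{(1)},\dots,\lambda^{(n)})$ of partitions which gives to such a sequence, with $\lambda^{(0)}=\varnothing$, the mass $$\mathbb P_{HL}\big(\lambda^{(1)},\dots,\lambda^{(n)}\big)=\frac{P_{\lambda^{(1)}/\lambda^{(0)}}(a_1)\cdots P_{\lambda^{(n)}/\lambda^{(n-1)}}(a_n)}{\Phi(a_1,\dots,a_n)}\,b^{\mathrm{el}}_{\lambda^{(n)}}\,\mathbf 1\{\text{all parts of the transpose of }\lambda^{(n)}\text{ are even}\}.$$ **Six-vertex side.** The stochastic six-vertex model in the half-quadrant $\{(x,y)\in\mathbb Z_{>0}^2:x\le y\}$ is the random configuration of up-right paths in which a path enters each vertex $(1,y)$ from the west, there is no south edge at the corners $(x,x)$, and the vertices are sampled successively and independently, given the states of their incoming edges, as follows. At a vertex $(x,y)$ with $x<y$ (write $u=a_xa_y$): if both or neither of the incoming (west, south) edges are occupied, then so are both, respectively neither, of the outgoing (east,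 north) edges; a single path coming from the west goes straight with probability $\frac{1-u}{1-tu}$ and turns up with probability $\frac{(1-t)u}{1-tu}$; a single path coming from the south goes straight with probability $\frac{t(1-u)}{1-tu}$ and turns right with probability $\frac{1-t}{1-tu}$. At a corner $(x,x)$ a path that enters from the west is absorbed, and if no path enters, a new path leaves to the north. The $n$-th path string is $\sigma_n=(s_1,\dots,s_n)$, with $s_k=1$ if the north edge of $(k,n)$ is occupied and $s_k=0$ otherwise, and $\mathfrak h(i,n)$ is the number of paths that cross the $n$-th horizontal line upwards in one of the columns $1,\dots,i$, that is, $\mathfrak h(i,n)=s_1+\dots+s_i$. **Theorem.** The masses $\mathbb P_{HL}$ are non-negative and $\mathbb P_{HL}$ is a probability measure. For every integer vector $(s_1,\dots,s_n)$, $$\mathbb P_{HL}\Big(\big(\ell(\lambda^{(i)})-\ell(\lambda^{(i-1)})\big)_{1\le i\le n}=(s_1,\dots,s_n)\Big)=\mathbb P\big(\sigma_n=(s_1,\dots,s_n)\big),$$ and consequently, for all non-negative integers $k_1,\dots,k_n$, $$\mathbb P_{HL}\big(\ell(\lambda^{(i)})=k_i,\ 1\le i\le n\big)=\mathbb P\big(\mathfrak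 h(i,n)=k_i,\ 1\le i\le n\big).$$ -/

import Mathlib

open MeasureTheory

/-! ### Partitions

Partitions are Young diagrams in English notation: the cell `(i, j)` lies in row `i` and column `j`
(both numbered from `0`), `lam.rowLen i` is the `(i+1)`-st part, `lam.colLen j` the `(j+1)`-st part
of the transposed partition, `lam.colLen 0` the number of non-zero parts, `⊥` the empty partition. -/

namespace HalfSpace

/-- The length of a partition: the number of its non-zero parts. -/
def len (lam : YoungDiagram) : ℕ := lam.colLen 0

/-- All parts of the transposed partition are even. -/
def TransposeEven (lam : YoungDiagram) : Prop := ∀ j, Even (lam.colLen j)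

/-- Number of cells of `lam` in the same row as `c`, strictly to its right. -/
def arm (lam : YoungDiagram) (c : ℕ × ℕ) : ℕ :=
  (lam.cells.filter fun d => d.1 = c.1 ∧ c.2 < d.2).card

/-- Number of cells of `lam` in the same column as `c`, strictly below it. -/
def leg (lam : YoungDiagram) (c : ℕ × ℕ) : ℕ :=
  (lam.cells.filter fun d => d.2 = c.2 ∧ c.1 < d.1).card

/-- The "even leg" coefficient, for general Macdonald parameters `q`, `t`. -/
noncomputable def bEl (q t : ℝ) (lam : YoungDiagram) : ℝ :=
  ∏ c ∈ lam.cells.filter fun c => Even (leg lam c),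
    (1 - q ^ arm lam c * t ^ (leg lam c + 1)) / (1 - q ^ (arm lam c + 1) * t ^ leg lam c)

/-! ### Hall–Littlewood functions -/

/-- `v_m(t) = ∏_{k=1}^m (1 - t^k) / (1 - t)`. -/
noncomputable def vFactor (t : ℝ) (m : ℕ) : ℝ :=
  ∏ k ∈ Finset.range m, (1 - t ^ (k + 1)) / (1 - t)

/-- The value of the Hall–Littlewood polynomial `P_lam(x_1, …, x_n; t)` at a point with pairwise
distinct coordinates:
`∏_j v_{m_j}(t)⁻¹ ∑_{σ ∈ S_n} σ (x^lam ∏_{i<j} (x_i - t x_j) / (x_i - x_j))`,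
where `m_j` is the number of `i ≤ n` with `lam_i = j` (including `j = 0`);
it is `0` if `lam` has more than `n` non-zero parts. -/
noncomputable def hallLittlewoodP (t : ℝ) {n : ℕ} (x : Fin n → ℝ) (lam : YoungDiagram) : ℝ :=
  if n < len lam then 0 else
    (∏ j ∈ Finset.range (lam.rowLen 0 + 1),
        vFactor t (Finset.univ.filter fun i : Fin n => lam.rowLen i = j).card)⁻¹ *
      ∑ σ : Equiv.Perm (Fin n),
        (∏ i, x (σ i) ^ lam.rowLen i) *
          ∏ i, ∏ j ∈ Finset.Ioi i, (x (σ i) - t * x (σ j)) / (x (σ i) - x (σ j))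

/-- `c mu = P_{lam/mu}(z; t)` for all `mu`: the skew functions in the single variable `z` are the
coefficients in `P_lam(z, x_1, …, x_N) = ∑_mu P_{lam/mu}(z) P_mu(x_1, …, x_N)`, for every number `N`
of further variables. (It is enough to test points with distinct coordinates.) -/
def IsSkewExpansion (t z : ℝ) (lam : YoungDiagram) (c : YoungDiagram →₀ ℝ) : Prop :=
  ∀ (N : ℕ) (x : Fin N → ℝ), Function.Injective (Fin.cons z x : Fin (N + 1) → ℝ) →
    hallLittlewoodP t (Fin.cons z x : Fin (N + 1) → ℝ) lam =
      c.sum fun mu r => r * hallLittlewoodP t x mu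

open Classical in
/-- The skew Hall–Littlewood function `P_{lam/mu}(z; t)` in one variable `z`: the coefficient of
`P_mu` in the (unique) expansion of `P_lam(z, x_1, x_2, …)`. -/
noncomputable def skewP (t : ℝ) (lam mu : YoungDiagram) (z : ℝ) : ℝ :=
  if h : ∃ c : YoungDiagram →₀ ℝ, IsSkewExpansion t z lam c then h.choose mu else 0

/-! ### The ascending half-space Hall–Littlewood process

The parameters are `a 0, …, a (n-1)` (for `a_1, …, a_n`), and a sequence
`lam^{(1)}, …, lam^{(n)}` is a map `L : Fin n → YoungDiagram`. -/

/-- `Φ(a_1, …, a_n) = ∏_{i<j} (1 - t a_i a_j) / (1 - a_i a_j)`. -/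
noncomputable def Phi (t : ℝ) (a : ℕ → ℝ) (n : ℕ) : ℝ :=
  ∏ i : Fin n, ∏ j ∈ Finset.Ioi i, (1 - t * (a i * a j)) / (1 - a i * a j)

/-- The sequence `∅ = lam^{(0)}, lam^{(1)}, …, lam^{(n)}`. -/
def extend {n : ℕ} (L : Fin n → YoungDiagram) : Fin (n + 1) → YoungDiagram := Fin.cons ⊥ L

open Classical in
/-- The probability of a sequence of partitions. -/
noncomputable def weightHL (t : ℝ) (a : ℕ → ℝ) {n : ℕ} (L : Fin n → YoungDiagram) : ℝ :=
  (∏ i : Fin n, skewP t (extend L i.succ) (extend L i.castSucc) (a i)) / Phi t a n *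
    bEl 0 t (extend L (Fin.last n)) * (if TransposeEven (extend L (Fin.last n)) then 1 else 0)

instance : MeasurableSpace YoungDiagram := ⊤

/-- The law of the ascending half-space Hall–Littlewood process. -/
noncomputable def PHL (t : ℝ) (a : ℕ → ℝ) (n : ℕ) : Measure (Fin n → YoungDiagram) :=
  Measure.sum fun L => ENNReal.ofReal (weightHL t a L) • Measure.dirac L

/-- The vector of increments `ℓ(lam^{(i)}) - ℓ(lam^{(i-1)})`, `1 ≤ i ≤ n`. -/
def support {n : ℕ} (L : Fin n → YoungDiagram) (i : Fin n) : ℤ :=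
  (len (extend L i.succ) : ℤ) - len (extend L i.castSucc)

/-! ### The stochastic six-vertex model in the half-quadrant

Columns and rows are numbered from `0`: the vertex `(x, y)`, `x ≤ y`, stands for the vertex
`(x+1, y+1)` of `{(x, y) ∈ ℤ_{>0}² : x ≤ y}`, and its parameters are `a x` and `a y`.
The states `true` / `false` of an edge mean occupied / empty. The vertices are sampled with
independent random numbers, uniform on `[0, 1]`, one for each vertex. -/

/-- Sampling of a bulk vertex with `u = a_x a_y`: from the states of the west and the south edge and
the uniform number `r`, the states of the east and the north edge. A path alone from the west
goes straight with probability `(1-u)/(1-tu)` and turns up with probability `(1-t)u/(1-tu)`;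
a path alone from the south goes straight with probability `t(1-u)/(1-tu)` and turns right with
probability `(1-t)/(1-tu)`. -/
noncomputable def bulkVertex (t u r : ℝ) : (west south : Bool) → Bool × Bool
  | false, false => (false, false)
  | true, true => (true, true)
  | true, false => if r < (1 - u) / (1 - t * u) then (true, false) else (false, true)
  | false, true => if r < t * (1 - u) / (1 - t * u) then (false, true) else (true, false)

/-- A sample point: one number in `[0, 1]` for each vertex. -/
abbrev Sample : Type := ℕ × ℕ → unitInterval

/-- The probability measure under which these numbers are independent and uniform. -/
noncomputable def sampleMeasure : Measure Sample :=
  Measure.infinitePi fun _ : ℕ × ℕ => (volume : Measure unitInterval)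

/-- The west edges of the vertices of row `y`, given the south edges of that row.
A path enters from the left in every row. -/
noncomputable def westEdge (t : ℝ) (a : ℕ → ℝ) (ω : Sample) (y : ℕ) (south : ℕ → Bool) : ℕ → Bool
  | 0 => true
  | x + 1 => (bulkVertex t (a x * a y) (ω (x, y)) (westEdge t a ω y south x) (south x)).1

/-- `pathsAbove t a ω n x` is the state of the vertical edge of column `x` that leaves the `n`-th
horizontal line (the row with index `n - 1`) to the north; `n = 0` refers to the empty edges below
the first line. In row `n` the vertices `(x, n)` with `x < n` are bulk vertices, and `(n, n)` is a
corner, which absorbs a path that enters it from the west and otherwise emits a path to the north.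
The value is `false` where there is no edge (`n ≤ x`). -/
noncomputable def pathsAbove (t : ℝ) (a : ℕ → ℝ) (ω : Sample) : ℕ → ℕ → Bool
  | 0 => fun _ => false
  | n + 1 => fun x =>
      let south := pathsAbove t a ω n
      if x < n then
        (bulkVertex t (a x * a n) (ω (x, n)) (westEdge t a ω n south x) (south x)).2
      else if x = n then !(westEdge t a ω n south n)
      else false

/-- The `n`-th path string `(s_1, …, s_n) ∈ {0,1}^n`. -/
noncomputable def pathString (t : ℝ) (a : ℕ → ℝ) (n : ℕ) (ω : Sample) (k : Fin n) : ℤ :=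
  if pathsAbove t a ω n k then 1 else 0

/-- The height `h(x, n)`, `1 ≤ x ≤ n`: the number of paths that cross the `n`-th horizontal line
upwards in one of the first `x` columns. -/
noncomputable def height (t : ℝ) (a : ℕ → ℝ) (x n : ℕ) (ω : Sample) : ℕ :=
  ((Finset.range x).filter fun k => pathsAbove t a ω n k = true).card

end HalfSpace

/-!
The joint law of the lengths of the partitions is computed column by column, and the law of the path
string of the six-vertex model row by row; both turn out to be the same fixed vector of one
transfer matrix.

*Branching.* The skew functions `P_{lam/mu}(z)` are defined through an expansion, so that their
values have to be found first. For pairwise distinct variables, `HL` rewrites the symmetrization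
formula as a recursion on the columns of `lam`: one sums over the set `I` of variables with a
positive exponent, takes out their product and removes the first column (`symmSum_eq`,
`hallLittlewoodP_eq`). Partial fractions in `z` turn this recursion into the branching rule
`HL_insert`, whose coefficients `skewComb` are again given by a recursion on the columns
(`skewComb_apply`). The expansion is unique because Hall–Littlewood polynomials are linearly
independent (`eq_zero_of_linearCombination_HL`), hence `skewP_eq`.

*Half-space process.* The coefficient `b^el` at `q = 0`, with the parity condition, also factorizes
over the columns (`evenWeight_eq`). Thus, if `G s` is the total weight of all sequences of
partitions whose lengths have the increments `s`, removing the first columns gives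
`G s = ∑ s', T s s' * G s'`, where `T` is the matrix `transfer` (`supportSum_eq_sum_transfer`). In
`T s s'` a counter `m`, the difference of the lengths of two consecutive columns, runs through the
string, and a boundary weight `endWeight` is applied to its last value.

*Six-vertex model.* The law `p` of the path string satisfies `p s = ∑ s', T s s' * p s'` as well
(`stringProb_eq_sum_transfer`): the transfer line of `T` can be pulled through a row of the
six-vertex model, by a Yang–Baxter equation in each column (`yang_baxter`) and a reflection equation
at the corner (`reflection`), and induction on the number of rows applies.

*Conclusion.* `T` is triangular for the order given by partial sums, and its diagonal entries are
less than `1` except at the empty string, so that a fixed vector is determined by its value at the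
empty string (`eq_zero_of_transfer_fixed`). There `G` is `1`, and `p` is `1 / Φ`
(`stringProb_empty`). To know beforehand that `G` is finite, one bounds by `Φ * p` the contribution
of the partitions with at most `K` columns, by induction on `K` (`supportSum_le`). Hence `G = Φ * p`,
which also gives the total mass.
-/

namespace HalfSpace

/-! ### Young diagrams, column by column -/

/-- The diagram with its first column removed. -/
def dropCol (lam : YoungDiagram) : YoungDiagram where
  cells := (lam.cells.filter fun c => 0 < c.2).image fun c => (c.1, c.2 - 1)
  isLowerSet := by
    rintro ⟨i, j⟩ ⟨i', j'⟩ ⟨h1, h2⟩ h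
    simp only [Finset.coe_image, Finset.coe_filter, Set.mem_image, Set.mem_ofPred_eq, Prod.exists,
      Prod.mk.injEq, YoungDiagram.mem_cells] at h ⊢
    obtain ⟨k, l, ⟨hkl, hl⟩, rfl, rfl⟩ := h
    simp only at h2
    exact ⟨i', j' + 1, ⟨lam.up_left_mem h1 (by omega) hkl, by omega⟩, rfl, by omega⟩

/-- The diagram with a column of length `c` added on the left; if `c` is too small for this, the
new column has the length of the first column of `kap`. -/
def addCol (c : ℕ) (kap : YoungDiagram) : YoungDiagram where
  cells := ((Finset.range (max c (len kap))).image fun i => (i, 0)) ∪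
    kap.cells.image fun d => (d.1, d.2 + 1)
  isLowerSet := by
    rintro ⟨i, j⟩ ⟨i', j'⟩ ⟨h1, h2⟩ h
    simp only [Finset.coe_union, Finset.coe_image, Set.mem_union, Set.mem_image, Finset.mem_coe,
      Finset.mem_range, Prod.exists, Prod.mk.injEq, YoungDiagram.mem_cells] at h h1 h2 ⊢
    rcases h with ⟨k, hk, rfl, rfl⟩ | ⟨k, l, hkl, rfl, rfl⟩
    · exact Or.inl ⟨i', by omega, rfl, by omega⟩
    · rcases j' with _ | j'
      · have := YoungDiagram.mem_iff_lt_colLen.1 (kap.up_left_mem h1 (Nat.zero_le _) hkl)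
        exact Or.inl ⟨i', by unfold len; omega, rfl, rfl⟩
      · exact Or.inr ⟨i', j', kap.up_left_mem h1 (by omega) hkl, rfl, rfl⟩

theorem mem_dropCol {lam : YoungDiagram} {i j : ℕ} : (i, j) ∈ dropCol lam ↔ (i, j + 1) ∈ lam := by
  rw [← YoungDiagram.mem_cells, ← YoungDiagram.mem_cells]
  simp only [dropCol, Finset.mem_image, Finset.mem_filter, Prod.exists, Prod.mk.injEq]
  constructor
  · rintro ⟨k, l, ⟨h, hl⟩, rfl, rfl⟩
    rwa [Nat.sub_add_cancel hl]
  · intro h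
    exact ⟨i, j + 1, ⟨h, by omega⟩, rfl, by omega⟩

theorem mem_addCol_zero {c : ℕ} {kap : YoungDiagram} {i : ℕ} :
    (i, 0) ∈ addCol c kap ↔ i < max c (len kap) := by
  rw [← YoungDiagram.mem_cells]
  simp [addCol]

theorem mem_addCol_succ {c : ℕ} {kap : YoungDiagram} {i j : ℕ} :
    (i, j + 1) ∈ addCol c kap ↔ (i, j) ∈ kap := by
  rw [← YoungDiagram.mem_cells, ← YoungDiagram.mem_cells]
  simp [addCol]

theorem len_addCol {c : ℕ} {kap : YoungDiagram} (h : len kap ≤ c) : len (addCol c kap) = c := by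
  have key : ∀ i, i < len (addCol c kap) ↔ i < c := fun i => by
    rw [len, ← YoungDiagram.mem_iff_lt_colLen, mem_addCol_zero, max_eq_left h]
  exact le_antisymm (not_lt.1 fun h' => lt_irrefl _ ((key _).1 h'))
    (not_lt.1 fun h' => lt_irrefl _ ((key _).2 h'))

theorem colLen_dropCol (lam : YoungDiagram) (j : ℕ) :
    (dropCol lam).colLen j = lam.colLen (j + 1) := by
  have key : ∀ i, i < (dropCol lam).colLen j ↔ i < lam.colLen (j + 1) := fun i => by
    rw [← YoungDiagram.mem_iff_lt_colLen, ← YoungDiagram.mem_iff_lt_colLen, mem_dropCol]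
  exact le_antisymm (not_lt.1 fun h' => lt_irrefl _ ((key _).1 h'))
    (not_lt.1 fun h' => lt_irrefl _ ((key _).2 h'))

theorem rowLen_dropCol (lam : YoungDiagram) (i : ℕ) :
    (dropCol lam).rowLen i = lam.rowLen i - 1 := by
  have key : ∀ j, j < (dropCol lam).rowLen i ↔ j < lam.rowLen i - 1 := fun j => by
    rw [← YoungDiagram.mem_iff_lt_rowLen, mem_dropCol, YoungDiagram.mem_iff_lt_rowLen]
    omega
  exact le_antisymm (not_lt.1 fun h' => lt_irrefl _ ((key _).1 h'))
    (not_lt.1 fun h' => lt_irrefl _ ((key _).2 h'))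

theorem dropCol_addCol (c : ℕ) (kap : YoungDiagram) : dropCol (addCol c kap) = kap := by
  ext ⟨i, j⟩
  rw [YoungDiagram.mem_cells, YoungDiagram.mem_cells, mem_dropCol, mem_addCol_succ]

theorem len_dropCol_le (lam : YoungDiagram) : len (dropCol lam) ≤ len lam := by
  rw [len, colLen_dropCol]
  exact lam.colLen_anti 0 1 (by norm_num)

theorem addCol_dropCol (lam : YoungDiagram) : addCol (len lam) (dropCol lam) = lam := by
  ext ⟨i, j⟩
  rw [YoungDiagram.mem_cells, YoungDiagram.mem_cells]
  rcases j with _ | j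
  · rw [mem_addCol_zero, max_eq_left (len_dropCol_le lam), YoungDiagram.mem_iff_lt_colLen, len]
  · rw [mem_addCol_succ, mem_dropCol]

theorem addCol_eq_iff {c : ℕ} {nu mu : YoungDiagram} (h : len nu ≤ c) :
    addCol c nu = mu ↔ len mu = c ∧ dropCol mu = nu := by
  constructor
  · rintro rfl
    exact ⟨len_addCol h, dropCol_addCol c nu⟩
  · rintro ⟨rfl, rfl⟩
    exact addCol_dropCol mu

theorem len_bot : len ⊥ = 0 := by
  rw [len, ← not_lt.trans Nat.le_zero, ← YoungDiagram.mem_iff_lt_colLen]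
  exact YoungDiagram.notMem_bot _

theorem len_eq_zero {lam : YoungDiagram} : len lam = 0 ↔ lam = ⊥ := by
  refine ⟨fun h => ?_, fun h => h ▸ len_bot⟩
  ext ⟨i, j⟩
  rw [YoungDiagram.mem_cells, YoungDiagram.mem_cells]
  refine ⟨fun hm => ?_, fun hm => absurd hm (YoungDiagram.notMem_bot _)⟩
  have := YoungDiagram.mem_iff_lt_colLen.1 (lam.up_left_mem le_rfl (Nat.zero_le j) hm)
  rw [len] at h
  omega

theorem dropCol_bot : dropCol ⊥ = ⊥ := by
  rw [← len_eq_zero, ← Nat.le_zero]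
  exact (len_dropCol_le ⊥).trans len_bot.le

theorem card_eq_len_add (lam : YoungDiagram) : lam.card = len lam + (dropCol lam).card := by
  have h : lam.cells = (addCol (len lam) (dropCol lam)).cells := by rw [addCol_dropCol]
  rw [YoungDiagram.card, h]
  have inj : Function.Injective fun d : ℕ × ℕ => (d.1, d.2 + 1) := by
    rintro ⟨a, b⟩ ⟨c, d⟩ h
    simp only [Prod.mk.injEq, Nat.add_right_cancel_iff] at h
    exact Prod.ext h.1 h.2
  have inj' : Function.Injective fun i : ℕ => (i, 0) := fun a b h => (Prod.mk.inj h).1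
  simp only [addCol]
  rw [Finset.card_union_of_disjoint, Finset.card_image_of_injective _ inj',
    Finset.card_image_of_injective _ inj, Finset.card_range, max_eq_left (len_dropCol_le lam)]
  rw [Finset.disjoint_left]
  simp

theorem card_dropCol_lt {lam : YoungDiagram} (h : lam ≠ ⊥) : (dropCol lam).card < lam.card := by
  have := card_eq_len_add lam
  have := mt len_eq_zero.1 h
  omega

/-- Induction on the number of columns. -/
theorem column_induction {p : YoungDiagram → Prop} (bot : p ⊥)
    (step : ∀ lam, lam ≠ ⊥ → p (dropCol lam) → p lam) (lam : YoungDiagram) : p lam := by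
  induction h : lam.card using Nat.strong_induction_on generalizing lam with
  | _ n ih =>
    by_cases hl : lam = ⊥
    · exact hl ▸ bot
    · exact step lam hl (ih _ (h ▸ card_dropCol_lt hl) _ rfl)

/-! ### Partial fractions and `t`-numbers -/

/-- The `t`-number `1 + t + ⋯ + t^(n-1)`. -/
def tNum (t : ℝ) (n : ℕ) : ℝ := ∑ k ∈ Finset.range n, t ^ k

theorem tNum_succ (t : ℝ) (n : ℕ) : tNum t (n + 1) = tNum t n + t ^ n := Finset.sum_range_succ _ _

theorem one_sub_mul_tNum (t : ℝ) (n : ℕ) : (1 - t) * tNum t n = 1 - t ^ n := mul_neg_geom_sum t n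

theorem tNum_succ_sub (t : ℝ) (n : ℕ) : tNum t (n + 1) - t * tNum t n = 1 := by
  have := one_sub_mul_tNum t n
  rw [tNum_succ]
  linarith

/-- Partial fraction expansion in `z`. -/
theorem prod_div_sub_eq (α β : ℝ) (T : Finset ℝ) {z : ℝ} (hz : z ∉ T) :
    ∏ i ∈ T, (α * z - β * i) / (z - i) =
      α ^ T.card + ∑ y ∈ T, (α - β) * y / (z - y) * ∏ i ∈ T.erase y, (α * y - β * i) / (y - i) := by
  induction T using Finset.induction_on generalizing z with
  | empty => simp
  | insert w T hw ih =>
    have hzw : z - w ≠ 0 := sub_ne_zero.2 fun h => hz (by simp [h])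
    have hzT : z ∉ T := fun h => hz (Finset.mem_insert_of_mem h)
    rw [Finset.prod_insert hw, Finset.sum_insert hw, Finset.erase_insert hw,
      Finset.card_insert_of_notMem hw, ih hzT, ih hw]
    have hs : ∑ y ∈ T, (α - β) * y / (z - y) *
          ∏ i ∈ (insert w T).erase y, (α * y - β * i) / (y - i) =
        (α * z - β * w) / (z - w) * (∑ y ∈ T, (α - β) * y / (z - y) *
          ∏ i ∈ T.erase y, (α * y - β * i) / (y - i)) -
        (α - β) * w / (z - w) * ∑ y ∈ T, (α - β) * y / (w - y) *
          ∏ i ∈ T.erase y, (α * y - β * i) / (y - i) := by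
      rw [Finset.mul_sum, Finset.mul_sum, ← Finset.sum_sub_distrib]
      refine Finset.sum_congr rfl fun y hy => ?_
      have hyw : y ≠ w := fun h => hw (h ▸ hy)
      have h1 : y - w ≠ 0 := sub_ne_zero.2 hyw
      have h2 : w - y ≠ 0 := sub_ne_zero.2 hyw.symm
      have h3 : z - y ≠ 0 := sub_ne_zero.2 fun h => hzT (h ▸ hy)
      rw [Finset.erase_insert_of_ne hyw.symm, Finset.prod_insert (by simp [hw])]
      have h4 : w - y = -(y - w) := by ring
      rw [h4]
      field_simp
      ring
    rw [hs]
    have : (α * z - β * w) / (z - w) = α + (α - β) * w / (z - w) := by field_simp; ring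
    rw [this]
    ring

/-- The product of `(x - t y) / (x - y)` over `x ∈ A`, `y ∈ B`. -/
noncomputable def cross (t : ℝ) (A B : Finset ℝ) : ℝ :=
  ∏ x ∈ A, ∏ y ∈ B, (x - t * y) / (x - y)

theorem cross_union_left {t : ℝ} {A B C : Finset ℝ} (h : Disjoint A B) :
    cross t (A ∪ B) C = cross t A C * cross t B C := Finset.prod_union h

theorem cross_insert_left {t y : ℝ} {A C : Finset ℝ} (h : y ∉ A) :
    cross t (insert y A) C = cross t {y} C * cross t A C := by
  simp only [cross, Finset.prod_insert h, Finset.prod_singleton]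

theorem cross_insert_right {t y : ℝ} {A C : Finset ℝ} (h : y ∉ C) :
    cross t A (insert y C) = cross t A {y} * cross t A C := by
  simp only [cross, Finset.prod_insert h, Finset.prod_mul_distrib, Finset.prod_singleton]

theorem cross_empty_left (t : ℝ) (A : Finset ℝ) : cross t ∅ A = 1 := by simp [cross]

theorem cross_empty_right (t : ℝ) (A : Finset ℝ) : cross t A ∅ = 1 := by simp [cross]

theorem cross_singleton_left (t : ℝ) {T : Finset ℝ} {z : ℝ} (hz : z ∉ T) :
    cross t {z} T = 1 + ∑ y ∈ T, (1 - t) * y / (z - y) * cross t {y} (T.erase y) := by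
  have := prod_div_sub_eq 1 t T hz
  simpa only [cross, Finset.prod_singleton, one_mul, one_pow] using this

theorem cross_singleton_right (t : ℝ) {T : Finset ℝ} {z : ℝ} (hz : z ∉ T) :
    cross t T {z} =
      t ^ T.card - ∑ y ∈ T, (1 - t) * y / (z - y) * cross t (T.erase y) {y} := by
  have h := prod_div_sub_eq t 1 T hz
  have e : ∀ z i : ℝ, (t * z - 1 * i) / (z - i) = (i - t * z) / (i - z) := fun z i => by
    rw [← neg_div_neg_eq]
    ring
  simp only [e] at h
  simp only [cross, Finset.prod_singleton]
  rw [h, sub_eq_add_neg (t ^ T.card), ← Finset.sum_neg_distrib]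
  congr 1
  refine Finset.sum_congr rfl fun y _ => ?_
  ring

/-- The identity behind `∑_σ σ (∏_{i<j} (x_i - t x_j) / (x_i - x_j)) = v_n(t)`. -/
theorem sum_cross_erase (t : ℝ) (T : Finset ℝ) :
    ∑ y ∈ T, cross t (T.erase y) {y} = tNum t T.card := by
  induction T using Finset.induction_on with
  | empty => simp [tNum]
  | insert z T hz ih =>
    rw [Finset.sum_insert hz, Finset.erase_insert hz, Finset.card_insert_of_notMem hz, tNum_succ,
      cross_singleton_right t hz, ← ih]
    have : ∑ y ∈ T, cross t ((insert z T).erase y) {y} = ∑ y ∈ T, cross t (T.erase y) {y} +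
        ∑ y ∈ T, (1 - t) * y / (z - y) * cross t (T.erase y) {y} := by
      rw [← Finset.sum_add_distrib]
      refine Finset.sum_congr rfl fun y hy => ?_
      have hyz : y ≠ z := fun h => hz (h ▸ hy)
      have hzy : z - y ≠ 0 := sub_ne_zero.2 hyz.symm
      have : cross t {z} {y} = (z - t * y) / (z - y) := by simp [cross]
      rw [Finset.erase_insert_of_ne hyz.symm, cross_insert_left (by simp [hz]), this]
      field_simp
      ring
    rw [this]
    ring

/-! ### Hall–Littlewood polynomials on finite sets of reals -/

/-- The Hall–Littlewood polynomial of `lam` at the pairwise distinct variables in `S`, by recursion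
on the columns of `lam`: the variables in `I` are those that carry a positive exponent. -/
noncomputable def HL (t : ℝ) (lam : YoungDiagram) (S : Finset ℝ) : ℝ :=
  open Classical in
  if _h : lam = ⊥ then 1 else
    ∑ I ∈ S.powersetCard (len lam), (∏ x ∈ I, x) * cross t I (S \ I) * HL t (dropCol lam) I
termination_by lam.card
decreasing_by exact card_dropCol_lt _h

theorem HL_bot (t : ℝ) (S : Finset ℝ) : HL t ⊥ S = 1 := by
  rw [HL, dif_pos rfl]

theorem HL_eq (t : ℝ) (lam : YoungDiagram) (S : Finset ℝ) :
    HL t lam S =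
      ∑ I ∈ S.powersetCard (len lam), (∏ x ∈ I, x) * cross t I (S \ I) * HL t (dropCol lam) I := by
  by_cases h : lam = ⊥
  · subst h
    rw [HL_bot, len_bot, Finset.powersetCard_zero, Finset.sum_singleton, cross_empty_left,
      dropCol_bot, HL_bot]
    simp
  · rw [HL, dif_neg h]

theorem HL_eq_zero {t : ℝ} {lam : YoungDiagram} {S : Finset ℝ} (h : S.card < len lam) :
    HL t lam S = 0 := by
  rw [HL_eq, Finset.powersetCard_eq_empty.2 h, Finset.sum_empty]

theorem HL_of_card_eq {t : ℝ} {lam : YoungDiagram} {S : Finset ℝ} (h : S.card = len lam) :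
    HL t lam S = (∏ x ∈ S, x) * HL t (dropCol lam) S := by
  rw [HL_eq, ← h, Finset.powersetCard_self, Finset.sum_singleton, Finset.sdiff_self,
    cross_empty_right, mul_one]

theorem HL_addCol {t : ℝ} {c : ℕ} {nu : YoungDiagram} (h : len nu ≤ c) (S : Finset ℝ) :
    HL t (addCol c nu) S =
      ∑ I ∈ S.powersetCard c, (∏ x ∈ I, x) * cross t I (S \ I) * HL t nu I := by
  rw [HL_eq, len_addCol h, dropCol_addCol]

/-- One step of the symmetrization formula, in which the last variable `y` has exponent `0`; the
factor on the right is a `t`-deformation of the number of such variables. -/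
theorem sum_HL_erase (t : ℝ) (kap : YoungDiagram) (S : Finset ℝ) :
    ∑ y ∈ S, HL t kap (S.erase y) * cross t (S.erase y) {y} =
      tNum t (S.card - len kap) * HL t kap S := by
  have step : ∀ y ∈ S, HL t kap (S.erase y) * cross t (S.erase y) {y} =
      ∑ I ∈ (S.erase y).powersetCard (len kap), (∏ x ∈ I, x) * cross t I (S \ I) *
        HL t (dropCol kap) I * cross t ((S \ I).erase y) {y} := by
    intro y hy
    rw [HL_eq, Finset.sum_mul]
    refine Finset.sum_congr rfl fun I hI => ?_
    obtain ⟨hI, -⟩ := Finset.mem_powersetCard.1 hI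
    have hyI : y ∉ I := fun h => (Finset.mem_erase.1 (hI h)).1 rfl
    have hyS : y ∈ S \ I := Finset.mem_sdiff.2 ⟨hy, hyI⟩
    have e1 : S.erase y = I ∪ (S \ I).erase y := by
      ext x
      have := @hI x
      simp only [Finset.mem_erase, Finset.mem_union, Finset.mem_sdiff] at this ⊢
      tauto
    have d1 : Disjoint I ((S \ I).erase y) :=
      Finset.disjoint_of_subset_right (Finset.erase_subset _ _) Finset.disjoint_sdiff
    have e2 : S.erase y \ I = (S \ I).erase y := by
      ext x
      simp only [Finset.mem_erase, Finset.mem_sdiff]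
      tauto
    have e3 : cross t I (S \ I) = cross t I {y} * cross t I ((S \ I).erase y) := by
      conv_lhs => rw [← Finset.insert_erase hyS]
      exact cross_insert_right (Finset.notMem_erase _ _)
    rw [e2, e3, e1, cross_union_left d1]
    ring
  rw [Finset.sum_congr rfl step, Finset.sum_comm' (t' := S.powersetCard (len kap))
    (s' := fun I => S \ I), HL_eq t kap S, Finset.mul_sum]
  · refine Finset.sum_congr rfl fun I hI => ?_
    obtain ⟨hI, hc⟩ := Finset.mem_powersetCard.1 hI
    rw [← Finset.mul_sum, sum_cross_erase, Finset.card_sdiff_of_subset hI, hc]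
    ring
  · intro y I
    simp only [Finset.mem_powersetCard, Finset.mem_sdiff, Finset.subset_erase]
    tauto

/-! ### The branching rule -/

/-- The factor of a one-variable skew function `P_{lam/mu}` that comes from the first column, if
the first columns of `lam` and `mu` have the same length `l`; the second columns have the lengths
`k` and `j`. It is not `1` if the second column of the skew shape has a cell; then `l - j` is the
number of rows of length `1` of `mu`. -/
noncomputable def stayWeight (t : ℝ) (l k j : ℕ) : ℝ := if j = k then 1 else 1 - t ^ (l - j)

/-- The same factor if the first column of `mu` is one cell shorter than that of `lam`, which
requires that the second column of `mu` has length `j < l`. -/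
noncomputable def moveWeight (z : ℝ) (l j : ℕ) : ℝ := if j < l then z else 0

/-- The one-variable skew function `P_{lam/·}(z)` as a formal combination of partitions, by
recursion on the columns: the first column either keeps its length or loses one cell. -/
noncomputable def skewComb (t z : ℝ) (lam : YoungDiagram) : YoungDiagram →₀ ℝ :=
  open Classical in
  if _h : lam = ⊥ then Finsupp.single ⊥ 1 else
    Finsupp.linearCombination ℝ (fun nu =>
      Finsupp.single (addCol (len lam) nu) (stayWeight t (len lam) (len (dropCol lam)) (len nu)) +
      Finsupp.single (addCol (len lam - 1) nu) (moveWeight z (len lam) (len nu)))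
      (skewComb t z (dropCol lam))
termination_by lam.card
decreasing_by exact card_dropCol_lt _h

theorem skewComb_bot (t z : ℝ) : skewComb t z ⊥ = Finsupp.single ⊥ 1 := by
  rw [skewComb, dif_pos rfl]

theorem skewComb_eq (t z : ℝ) (lam : YoungDiagram) :
    skewComb t z lam = Finsupp.linearCombination ℝ (fun nu =>
      Finsupp.single (addCol (len lam) nu) (stayWeight t (len lam) (len (dropCol lam)) (len nu)) +
      Finsupp.single (addCol (len lam - 1) nu) (moveWeight z (len lam) (len nu)))
      (skewComb t z (dropCol lam)) := by
  by_cases h : lam = ⊥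
  · subst h
    have : addCol 0 ⊥ = ⊥ := by
      have := addCol_dropCol ⊥
      rwa [len_bot, dropCol_bot] at this
    simp [dropCol_bot, skewComb_bot, len_bot, stayWeight, moveWeight, this]
  · rw [skewComb, dif_neg h]

theorem linearCombination_skewComb (t z : ℝ) (lam : YoungDiagram) (f : YoungDiagram → ℝ) :
    Finsupp.linearCombination ℝ f (skewComb t z lam) =
      Finsupp.linearCombination ℝ (fun nu =>
        stayWeight t (len lam) (len (dropCol lam)) (len nu) * f (addCol (len lam) nu) +
        moveWeight z (len lam) (len nu) * f (addCol (len lam - 1) nu))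
        (skewComb t z (dropCol lam)) := by
  rw [skewComb_eq, Finsupp.linearCombination_linearCombination]
  congr 2
  ext nu
  simp [Finsupp.linearCombination_single]

theorem len_of_skewComb_ne_zero {t z : ℝ} {lam mu : YoungDiagram} (h : skewComb t z lam mu ≠ 0) :
    len mu = len lam ∨ len mu + 1 = len lam := by
  induction lam using column_induction generalizing mu with
  | bot =>
    rw [skewComb_bot] at h
    rw [(Finsupp.single_apply_ne_zero.1 h).1]
    exact Or.inl rfl
  | step lam hl ih =>
    rw [skewComb_eq, Finsupp.linearCombination_apply, Finsupp.sum, Finsupp.finsetSum_apply] at h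
    obtain ⟨nu, hnu, h⟩ := Finset.exists_ne_zero_of_sum_ne_zero h
    rw [Finsupp.smul_apply, Finsupp.add_apply] at h
    have hle : len nu ≤ len lam := by
      have := len_dropCol_le lam
      rcases ih (Finsupp.mem_support_iff.1 hnu) with h | h <;> omega
    by_cases h1 : addCol (len lam) nu = mu
    · exact Or.inl ((addCol_eq_iff hle).1 h1).1
    · rw [Finsupp.single_eq_of_ne (Ne.symm h1), zero_add] at h
      have h2 := Finsupp.single_apply_ne_zero.1 (smul_ne_zero_iff.1 h).2
      have h3 : len nu < len lam := by
        by_contra h3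
        exact h2.2 (if_neg h3)
      have := ((addCol_eq_iff (by omega)).1 h2.1.symm).1
      omega

theorem sum_linearCombination {ι : Type*} (s : Finset ι) (r : ι → ℝ) (f : ι → YoungDiagram → ℝ)
    (c : YoungDiagram →₀ ℝ) :
    Finsupp.linearCombination ℝ (fun nu => ∑ i ∈ s, r i * f i nu) c =
      ∑ i ∈ s, r i * Finsupp.linearCombination ℝ (f i) c := by
  simp only [Finsupp.linearCombination_apply, Finsupp.sum, smul_eq_mul, Finset.mul_sum]
  rw [Finset.sum_comm]
  refine Finset.sum_congr rfl fun i _ => Finset.sum_congr rfl fun nu _ => by ring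

/-- Sets `J` of size `c` with a further element `y` are sets `I` of size `c + 1` with a
distinguished element. -/
theorem sum_powersetCard_sdiff {c : ℕ} (S : Finset ℝ) (f : Finset ℝ → ℝ → ℝ) :
    ∑ J ∈ S.powersetCard c, ∑ y ∈ S \ J, f J y =
      ∑ I ∈ S.powersetCard (c + 1), ∑ y ∈ I, f (I.erase y) y := by
  rw [Finset.sum_sigma', Finset.sum_sigma']
  refine Finset.sum_bij' (fun p _ => ⟨insert p.2 p.1, p.2⟩) (fun p _ => ⟨p.1.erase p.2, p.2⟩)
    ?_ ?_ ?_ ?_ ?_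
  · rintro ⟨J, y⟩ h
    simp only [Finset.mem_sigma, Finset.mem_powersetCard, Finset.mem_sdiff] at h ⊢
    refine ⟨⟨Finset.insert_subset h.2.1 h.1.1, ?_⟩, Finset.mem_insert_self _ _⟩
    rw [Finset.card_insert_of_notMem h.2.2, h.1.2]
  · rintro ⟨I, y⟩ h
    simp only [Finset.mem_sigma, Finset.mem_powersetCard, Finset.mem_sdiff] at h ⊢
    refine ⟨⟨(Finset.erase_subset _ _).trans h.1.1, ?_⟩, h.1.1 h.2, Finset.notMem_erase _ _⟩
    rw [Finset.card_erase_of_mem h.2, h.1.2, Nat.add_sub_cancel]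
  · rintro ⟨J, y⟩ h
    simp only [Finset.mem_sigma, Finset.mem_sdiff] at h
    simp [Finset.erase_insert h.2.2]
  · rintro ⟨I, y⟩ h
    simp only [Finset.mem_sigma] at h
    simp [Finset.insert_erase h.2]
  · rintro ⟨J, y⟩ h
    simp only [Finset.mem_sigma, Finset.mem_sdiff] at h
    simp [Finset.erase_insert h.2.2]

/-- The one-column step of the branching rule: `kap` is the partition without its first column,
`I` the set of variables that carry a positive exponent. -/
theorem branching_step {t z : ℝ} {kap : YoungDiagram}
    (ih : ∀ S : Finset ℝ, z ∉ S → HL t kap (insert z S) =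
      Finsupp.linearCombination ℝ (fun mu => HL t mu S) (skewComb t z kap))
    {I : Finset ℝ} (hz : z ∉ I) (hI : len kap ≤ I.card) :
    cross t I {z} * HL t kap I + ∑ y ∈ I, (1 - t) * z / (z - y) *
        (HL t kap (insert z (I.erase y)) * cross t (I.erase y) {y}) =
      Finsupp.linearCombination ℝ (fun nu => stayWeight t I.card (len kap) (len nu) * HL t nu I)
        (skewComb t z kap) := by
  -- As `(1 - t) z / (z - y) = (z - t y) / (z - y) - t`, the left-hand side is a sum over all
  -- variables, including `z`, minus `t` times a sum over `I`; both are given by `sum_HL_erase`.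
  have h1 : cross t I {z} * HL t kap I + ∑ y ∈ I, (1 - t) * z / (z - y) *
        (HL t kap (insert z (I.erase y)) * cross t (I.erase y) {y}) =
      ∑ y ∈ insert z I, HL t kap ((insert z I).erase y) * cross t ((insert z I).erase y) {y} -
      t * ∑ y ∈ I, Finsupp.linearCombination ℝ (fun mu => HL t mu (I.erase y)) (skewComb t z kap) *
        cross t (I.erase y) {y} := by
    rw [Finset.sum_insert hz, Finset.erase_insert hz, Finset.mul_sum, add_sub_assoc,
      ← Finset.sum_sub_distrib, mul_comm (HL t kap I)]
    congr 1
    refine Finset.sum_congr rfl fun y hy => ?_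
    have hyz : y ≠ z := fun h => hz (h ▸ hy)
    have hzy : z - y ≠ 0 := sub_ne_zero.2 hyz.symm
    have hz' : z ∉ I.erase y := fun h => hz (Finset.mem_of_mem_erase h)
    have : cross t {z} {y} = (z - t * y) / (z - y) := by simp [cross]
    rw [← ih _ hz', Finset.erase_insert_of_ne hyz.symm, cross_insert_left hz', this]
    field_simp
    ring
  have h2 : ∑ y ∈ I, Finsupp.linearCombination ℝ (fun mu => HL t mu (I.erase y))
        (skewComb t z kap) * cross t (I.erase y) {y} =
      Finsupp.linearCombination ℝ (fun nu => tNum t (I.card - len nu) * HL t nu I)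
        (skewComb t z kap) := by
    simp only [← sum_HL_erase, mul_comm (HL t _ _)]
    rw [sum_linearCombination]
    exact Finset.sum_congr rfl fun y _ => mul_comm _ _
  rw [h1, sum_HL_erase, h2, ih I hz, Finset.card_insert_of_notMem hz, ← smul_eq_mul, ← smul_eq_mul]
  simp only [Finsupp.linearCombination_apply, Finsupp.sum, smul_eq_mul]
  rw [Finset.mul_sum, Finset.mul_sum, ← Finset.sum_sub_distrib]
  refine Finset.sum_congr rfl fun nu hnu => ?_
  rcases len_of_skewComb_ne_zero (Finsupp.mem_support_iff.1 hnu) with h | h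
  · rw [stayWeight, if_pos h, h, Nat.sub_add_comm hI]
    linear_combination (skewComb t z kap nu * HL t nu I) * tNum_succ_sub t (I.card - len kap)
  · have e : I.card + 1 - len kap = I.card - len nu := by omega
    rw [stayWeight, if_neg (by omega), e]
    linear_combination (skewComb t z kap nu * HL t nu I) * one_sub_mul_tNum t (I.card - len nu)

/-- The branching rule: `skewComb` gives the expansion in one of the variables. -/
theorem HL_insert (t z : ℝ) (lam : YoungDiagram) (S : Finset ℝ) (hz : z ∉ S) :
    HL t lam (insert z S) =
      Finsupp.linearCombination ℝ (fun mu => HL t mu S) (skewComb t z lam) := by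
  induction lam using column_induction generalizing S with
  | bot => simp [HL_bot, skewComb_bot]
  | step lam hl ih =>
    obtain ⟨c, hc⟩ : ∃ c, len lam = c + 1 := Nat.exists_eq_succ_of_ne_zero (mt len_eq_zero.1 hl)
    have hkap := len_dropCol_le lam
    set kap := dropCol lam with hkapdef
    -- The two sides, with the sum over `I` split according to whether `z ∈ I`.
    have hL : HL t lam (insert z S) =
        ∑ I ∈ S.powersetCard (c + 1), (∏ x ∈ I, x) * cross t I (S \ I) *
          (cross t I {z} * HL t kap I) +
        ∑ J ∈ S.powersetCard c, (z * ∏ x ∈ J, x) * (cross t {z} (S \ J) * cross t J (S \ J)) *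
          HL t kap (insert z J) := by
      rw [HL_eq, hc, Finset.powersetCard_succ_insert hz, Finset.sum_union, Finset.sum_image]
      · congr 1
        · refine Finset.sum_congr rfl fun I hI => ?_
          have hzI : z ∉ I := fun h => hz ((Finset.mem_powersetCard.1 hI).1 h)
          rw [Finset.insert_sdiff_of_notMem _ hzI,
            cross_insert_right fun h => hz (Finset.mem_sdiff.1 h).1]
          ring
        · refine Finset.sum_congr rfl fun J hJ => ?_
          have hzJ : z ∉ J := fun h => hz ((Finset.mem_powersetCard.1 hJ).1 h)
          have e : insert z S \ insert z J = S \ J := by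
            rw [Finset.insert_sdiff_insert, Finset.sdiff_insert_of_notMem hz]
          rw [e, Finset.prod_insert hzJ, cross_insert_left hzJ]
      · intro J hJ J' hJ' h
        have hzJ : z ∉ J := fun h => hz ((Finset.mem_powersetCard.1 hJ).1 h)
        have hzJ' : z ∉ J' := fun h => hz ((Finset.mem_powersetCard.1 hJ').1 h)
        rw [← Finset.erase_insert hzJ, ← Finset.erase_insert hzJ']
        exact congrArg (fun s => Finset.erase s z) h
      · rw [Finset.disjoint_left]
        intro I hI hI'
        obtain ⟨J, -, rfl⟩ := Finset.mem_image.1 hI'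
        exact hz ((Finset.mem_powersetCard.1 hI).1 (Finset.mem_insert_self _ _))
    have hR : Finsupp.linearCombination ℝ (fun mu => HL t mu S) (skewComb t z lam) =
        ∑ I ∈ S.powersetCard (c + 1), (∏ x ∈ I, x) * cross t I (S \ I) *
          Finsupp.linearCombination ℝ
            (fun nu => stayWeight t (c + 1) (len kap) (len nu) * HL t nu I) (skewComb t z kap) +
        ∑ J ∈ S.powersetCard c, (z * ∏ x ∈ J, x) * cross t J (S \ J) *
          HL t kap (insert z J) := by
      rw [linearCombination_skewComb, hc, ← hkapdef]
      have e1 : ∀ J ∈ S.powersetCard c, (z * ∏ x ∈ J, x) * cross t J (S \ J) *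
            HL t kap (insert z J) = (z * ∏ x ∈ J, x) * cross t J (S \ J) *
          Finsupp.linearCombination ℝ (fun nu => HL t nu J) (skewComb t z kap) := fun J hJ => by
        rw [ih J fun h => hz ((Finset.mem_powersetCard.1 hJ).1 h)]
      rw [Finset.sum_congr rfl e1, ← sum_linearCombination, ← sum_linearCombination,
        Finsupp.linearCombination_apply, Finsupp.linearCombination_apply,
        Finsupp.linearCombination_apply, ← Finsupp.sum_add]
      refine Finsupp.sum_congr fun nu hnu => ?_
      have hnu' : len nu ≤ c + 1 := by
        rcases len_of_skewComb_ne_zero (Finsupp.mem_support_iff.1 hnu) with h | h <;> omega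
      rw [← smul_add]
      congr 1
      congr 1
      · rw [HL_addCol hnu', Finset.mul_sum]
        refine Finset.sum_congr rfl fun I _ => ?_
        ring
      · rw [Nat.add_sub_cancel, moveWeight]
        split_ifs with h
        · rw [HL_addCol (by omega), Finset.mul_sum]
          refine Finset.sum_congr rfl fun I _ => ?_
          ring
        · rw [zero_mul]
          refine (Finset.sum_eq_zero fun J hJ => ?_).symm
          rw [HL_eq_zero (by rw [(Finset.mem_powersetCard.1 hJ).2]; omega), mul_zero]
    -- Partial fractions move the difference of the terms with `z ∈ I` to the terms with `z ∉ I`.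
    have hM : ∑ J ∈ S.powersetCard c, (z * ∏ x ∈ J, x) *
          (cross t {z} (S \ J) * cross t J (S \ J)) * HL t kap (insert z J) =
        ∑ J ∈ S.powersetCard c, (z * ∏ x ∈ J, x) * cross t J (S \ J) * HL t kap (insert z J) +
        ∑ I ∈ S.powersetCard (c + 1), (∏ x ∈ I, x) * cross t I (S \ I) *
          ∑ y ∈ I, (1 - t) * z / (z - y) *
            (HL t kap (insert z (I.erase y)) * cross t (I.erase y) {y}) := by
      have : ∑ I ∈ S.powersetCard (c + 1), (∏ x ∈ I, x) * cross t I (S \ I) *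
            ∑ y ∈ I, (1 - t) * z / (z - y) *
              (HL t kap (insert z (I.erase y)) * cross t (I.erase y) {y}) =
          ∑ J ∈ S.powersetCard c, ∑ y ∈ S \ J, (z * ∏ x ∈ J, x) * cross t J (S \ J) *
            HL t kap (insert z J) * ((1 - t) * y / (z - y) * cross t {y} ((S \ J).erase y)) := by
        rw [sum_powersetCard_sdiff]
        refine Finset.sum_congr rfl fun I hI => ?_
        rw [Finset.mul_sum]
        refine Finset.sum_congr rfl fun y hy => ?_
        have hIS := (Finset.mem_powersetCard.1 hI).1
        have hy' : y ∉ I.erase y := Finset.notMem_erase _ _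
        have e1 : S \ I.erase y = insert y (S \ I) := by
          ext x
          by_cases hx : x = y
          · simp [hx, hIS hy]
          · simp [hx]
        have hyS : y ∉ S \ I := fun h => (Finset.mem_sdiff.1 h).2 hy
        have e2 : cross t I (S \ I) = cross t {y} (S \ I) * cross t (I.erase y) (S \ I) := by
          rw [← cross_insert_left hy', Finset.insert_erase hy]
        rw [e1, Finset.erase_insert hyS, cross_insert_right hyS, e2,
          ← Finset.mul_prod_erase I (fun x => x) hy]
        ring
      rw [this, ← Finset.sum_add_distrib]
      refine Finset.sum_congr rfl fun J hJ => ?_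
      rw [cross_singleton_left t fun h => hz (Finset.mem_sdiff.1 h).1, ← Finset.mul_sum]
      ring
    rw [hL, hR, hM, add_left_comm, ← Finset.sum_add_distrib, add_comm]
    congr 1
    refine Finset.sum_congr rfl fun I hI => ?_
    obtain ⟨hIS, hIc⟩ := Finset.mem_powersetCard.1 hI
    rw [← mul_add, branching_step ih (fun h => hz (hIS h)) (by omega), hIc]

/-- The one-variable skew functions factorize over the columns. -/
theorem skewComb_apply (t z : ℝ) (lam mu : YoungDiagram) :
    skewComb t z lam mu =
      (if len mu = len lam then stayWeight t (len lam) (len (dropCol lam)) (len (dropCol mu))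
        else if len mu + 1 = len lam then z else 0) *
      skewComb t z (dropCol lam) (dropCol mu) := by
  classical
  have h0 := linearCombination_skewComb t z lam fun nu => if nu = mu then 1 else 0
  have h1 : Finsupp.linearCombination ℝ (fun nu => if nu = mu then (1 : ℝ) else 0)
      (skewComb t z lam) = skewComb t z lam mu := by
    rw [Finsupp.linearCombination_apply, Finsupp.sum]
    simp +contextual [eq_comm]
  have hmu := len_dropCol_le mu
  rw [← h1, h0, Finsupp.linearCombination_apply, Finsupp.sum_eq_single (dropCol mu)]
  · by_cases hc : skewComb t z (dropCol lam) (dropCol mu) = 0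
    · simp [hc]
    have hle : len (dropCol mu) ≤ len lam := by
      have := len_dropCol_le lam
      rcases len_of_skewComb_ne_zero hc with h | h <;> omega
    rw [smul_eq_mul, mul_comm]
    congr 1
    by_cases h2 : len (dropCol mu) < len lam
    · simp only [addCol_eq_iff hle, addCol_eq_iff (Nat.le_sub_one_of_lt h2), moveWeight, h2,
        and_true, if_true]
      split_ifs <;> first | omega | simp
    · rw [moveWeight, if_neg h2, zero_mul, add_zero]
      simp only [addCol_eq_iff hle, and_true]
      split_ifs <;> first | omega | simp
  · intro nu hnu hne
    have hle : len nu ≤ len lam := by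
      have := len_dropCol_le lam
      rcases len_of_skewComb_ne_zero hnu with h | h <;> omega
    have e1 : addCol (len lam) nu ≠ mu := fun h => hne ((addCol_eq_iff hle).1 h).2.symm
    rw [if_neg e1, mul_zero, zero_add]
    by_cases h2 : len nu < len lam
    · have e2 : addCol (len lam - 1) nu ≠ mu := fun h =>
        hne ((addCol_eq_iff (Nat.le_sub_one_of_lt h2)).1 h).2.symm
      rw [if_neg e2, mul_zero, smul_zero]
    · rw [moveWeight, if_neg h2, zero_mul, smul_zero]
  · simp

/-! ### The symmetrization formula -/

/-- The symmetrization sum of the Hall–Littlewood polynomial with exponents `e`, the variables being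
listed in reverse order. -/
noncomputable def symmSum (t : ℝ) {n : ℕ} (x : Fin n → ℝ) (e : Fin n → ℕ) : ℝ :=
  ∑ σ : Equiv.Perm (Fin n), (∏ i, x (σ i) ^ e i) *
    ∏ i, ∏ j ∈ Finset.Ioi i, (x (σ j) - t * x (σ i)) / (x (σ j) - x (σ i))

theorem prod_Ioi_rev {n : ℕ} (g : Fin n → Fin n → ℝ) :
    ∏ i, ∏ j ∈ Finset.Ioi i, g (Fin.rev i) (Fin.rev j) = ∏ i, ∏ j ∈ Finset.Ioi i, g j i := by
  have h1 : ∏ i : Fin n, ∏ j ∈ Finset.Ioi i, g (Fin.rev i) (Fin.rev j) =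
      ∏ i : Fin n, ∏ j ∈ Finset.Iio i, g i j := by
    rw [← Equiv.prod_comp Fin.revPerm]
    refine Finset.prod_congr rfl fun i _ => ?_
    refine Finset.prod_bij' (fun j _ => Fin.rev j) (fun j _ => Fin.rev j) ?_ ?_ ?_ ?_ ?_ <;>
      simp [Fin.rev_lt_iff, Fin.lt_rev_iff]
  rw [h1]
  exact Finset.prod_comm' (by simp)

theorem symmSum_rev (t : ℝ) {n : ℕ} (x : Fin n → ℝ) (e : Fin n → ℕ) :
    symmSum t x (fun i => e (Fin.rev i)) = ∑ σ : Equiv.Perm (Fin n), (∏ i, x (σ i) ^ e i) *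
      ∏ i, ∏ j ∈ Finset.Ioi i, (x (σ i) - t * x (σ j)) / (x (σ i) - x (σ j)) := by
  rw [symmSum, ← Equiv.sum_comp (Equiv.mulRight (Fin.revPerm (n := n)))]
  refine Finset.sum_congr rfl fun σ _ => ?_
  congr 1
  · rw [← Equiv.prod_comp Fin.revPerm]
    simp
  · rw [← prod_Ioi_rev]
    simp

theorem symmSum_add_one (t : ℝ) {n : ℕ} (x : Fin n → ℝ) (e : Fin n → ℕ) :
    symmSum t x (fun i => e i + 1) = (∏ i, x i) * symmSum t x e := by
  rw [symmSum, symmSum, Finset.mul_sum]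
  refine Finset.sum_congr rfl fun σ _ => ?_
  rw [← Equiv.prod_comp σ x, ← mul_assoc]
  simp only [pow_succ', Finset.prod_mul_distrib]

/-- Splitting the symmetrization sum according to the variable `x p` in the first position. -/
theorem symmSum_succ (t : ℝ) {n : ℕ} (x : Fin (n + 1) → ℝ) (e : Fin (n + 1) → ℕ) :
    symmSum t x e = ∑ p, x p ^ e 0 *
      (∏ i : Fin n, (x (Equiv.swap 0 p i.succ) - t * x p) / (x (Equiv.swap 0 p i.succ) - x p)) *
      symmSum t (fun i : Fin n => x (Equiv.swap 0 p i.succ)) (fun i => e i.succ) := by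
  rw [symmSum, ← Equiv.sum_comp Equiv.Perm.decomposeFin.symm, Fintype.sum_prod_type]
  refine Finset.sum_congr rfl fun p _ => ?_
  rw [symmSum, Finset.mul_sum]
  refine Finset.sum_congr rfl fun σ _ => ?_
  rw [Fin.prod_univ_succ, Fin.prod_univ_succ, Fin.prod_Ioi_zero]
  simp only [Fin.prod_Ioi_succ, Equiv.Perm.decomposeFin_symm_apply_zero,
    Equiv.Perm.decomposeFin_symm_apply_succ]
  rw [Equiv.prod_comp σ fun i : Fin n =>
    (x (Equiv.swap 0 p i.succ) - t * x p) / (x (Equiv.swap 0 p i.succ) - x p)]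
  ring

theorem rowLen_eq_zero {lam : YoungDiagram} {i : ℕ} : lam.rowLen i = 0 ↔ len lam ≤ i := by
  rw [← not_lt, len, ← YoungDiagram.mem_iff_lt_colLen, YoungDiagram.mem_iff_lt_rowLen]
  omega

/-- The number of the first `n` rows that have length `j`. -/
def rowMult (lam : YoungDiagram) (n j : ℕ) : ℕ :=
  (Finset.univ.filter fun i : Fin n => lam.rowLen i = j).card

theorem rowMult_eq (lam : YoungDiagram) (n j : ℕ) :
    rowMult lam n j = ∑ i ∈ Finset.range n, if lam.rowLen i = j then 1 else 0 := by
  rw [rowMult, Finset.card_filter,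
    Fin.sum_univ_eq_sum_range fun i => if lam.rowLen i = j then 1 else 0]

theorem rowMult_succ (lam : YoungDiagram) (n j : ℕ) :
    rowMult lam (n + 1) j = rowMult lam n j + if lam.rowLen n = j then 1 else 0 := by
  rw [rowMult_eq, rowMult_eq, Finset.sum_range_succ]

theorem rowMult_zero_right (lam : YoungDiagram) {n : ℕ} (h : len lam ≤ n) :
    rowMult lam n 0 = n - len lam := by
  induction n, h using Nat.le_induction with
  | base =>
    rw [rowMult_eq, Nat.sub_self]
    refine Finset.sum_eq_zero fun i hi => if_neg ?_
    rw [rowLen_eq_zero, not_le]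
    exact Finset.mem_range.1 hi
  | succ n h ih =>
    rw [rowMult_succ, ih, if_pos (rowLen_eq_zero.2 h)]
    omega

theorem rowMult_len_succ (lam : YoungDiagram) (j : ℕ) :
    rowMult lam (len lam) (j + 1) = rowMult (dropCol lam) (len lam) j := by
  rw [rowMult_eq, rowMult_eq]
  refine Finset.sum_congr rfl fun i hi => ?_
  have : lam.rowLen i ≠ 0 := fun h => by
    have := rowLen_eq_zero.1 h
    have := Finset.mem_range.1 hi
    omega
  rw [rowLen_dropCol]
  congr 1
  rw [eq_iff_iff]
  omega

/-- The normalizing factor of the symmetrization sum. -/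
noncomputable def normFactor (t : ℝ) (lam : YoungDiagram) (n : ℕ) : ℝ :=
  ∏ j ∈ Finset.range (lam.rowLen 0 + 1), vFactor t (rowMult lam n j)

theorem div_eq_tNum {t : ℝ} (ht : t < 1) (n : ℕ) : (1 - t ^ n) / (1 - t) = tNum t n := by
  rw [← one_sub_mul_tNum, mul_div_cancel_left₀ _ (by linarith)]

theorem vFactor_succ {t : ℝ} (ht : t < 1) (n : ℕ) :
    vFactor t (n + 1) = vFactor t n * tNum t (n + 1) := by
  rw [vFactor, vFactor, Finset.prod_range_succ, div_eq_tNum ht]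

theorem vFactor_pos {t : ℝ} (ht : t ∈ Set.Ico (0 : ℝ) 1) (n : ℕ) : 0 < vFactor t n := by
  refine Finset.prod_pos fun k _ => ?_
  exact div_pos (sub_pos.2 (pow_lt_one₀ ht.1 ht.2 k.succ_ne_zero)) (sub_pos.2 ht.2)

theorem normFactor_pos {t : ℝ} (ht : t ∈ Set.Ico (0 : ℝ) 1) (lam : YoungDiagram) (n : ℕ) :
    0 < normFactor t lam n := Finset.prod_pos fun _ _ => vFactor_pos ht _

theorem normFactor_succ {t : ℝ} (ht : t < 1) {lam : YoungDiagram} {n : ℕ} (h : len lam ≤ n) :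
    normFactor t lam (n + 1) = normFactor t lam n * tNum t (n + 1 - len lam) := by
  rw [normFactor, normFactor, Finset.prod_range_succ', Finset.prod_range_succ',
    rowMult_zero_right lam h, rowMult_zero_right lam (Nat.le_add_right_of_le h), Nat.sub_add_comm h,
    vFactor_succ ht, mul_assoc]
  congr 1
  refine Finset.prod_congr rfl fun j _ => ?_
  rw [rowMult_succ, if_neg (by rw [rowLen_eq_zero.2 h]; omega), add_zero]

theorem normFactor_len (t : ℝ) {lam : YoungDiagram} (h : lam ≠ ⊥) :
    normFactor t lam (len lam) = normFactor t (dropCol lam) (len lam) := by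
  have h0 : lam.rowLen 0 ≠ 0 := fun h' => h (len_eq_zero.1 (Nat.le_zero.1 (rowLen_eq_zero.1 h')))
  have h1 : lam.rowLen 0 = (dropCol lam).rowLen 0 + 1 := by
    rw [rowLen_dropCol]
    omega
  rw [normFactor, normFactor, Finset.prod_range_succ', rowMult_zero_right lam le_rfl, Nat.sub_self,
    h1]
  simp only [rowMult_len_succ]
  simp [vFactor]

theorem image_swap_succ {n : ℕ} {x : Fin (n + 1) → ℝ} (hx : Function.Injective x)
    (p : Fin (n + 1)) :
    Finset.univ.image (fun i : Fin n => x (Equiv.swap 0 p i.succ)) =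
      (Finset.univ.image x).erase (x p) := by
  ext y
  simp only [Finset.mem_image, Finset.mem_univ, true_and, Finset.mem_erase]
  constructor
  · rintro ⟨i, rfl⟩
    refine ⟨fun h => Fin.succ_ne_zero i ?_, _, rfl⟩
    exact (Equiv.swap 0 p).injective (by rw [hx h, Equiv.swap_apply_left])
  · rintro ⟨hne, j, rfl⟩
    have h0 : Equiv.swap 0 p j ≠ 0 := fun h => hne (congrArg x ((Equiv.swap 0 p).injective
      (h.trans (Equiv.swap_apply_right 0 p).symm)))
    obtain ⟨i, hi⟩ := Fin.exists_succ_eq.2 h0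
    exact ⟨i, by rw [hi, Equiv.swap_apply_self]⟩

/-- Adding a variable that has exponent `0` in the leading monomial. -/
theorem symmSum_eq_succ {t : ℝ} (ht : t < 1) {lam : YoungDiagram} {n : ℕ} (h : len lam ≤ n)
    (ih : ∀ x : Fin n → ℝ, Function.Injective x →
      symmSum t x (fun i => lam.rowLen (Fin.rev i)) =
        normFactor t lam n * HL t lam (Finset.univ.image x))
    (x : Fin (n + 1) → ℝ) (hx : Function.Injective x) :
    symmSum t x (fun i => lam.rowLen (Fin.rev i)) =
      normFactor t lam (n + 1) * HL t lam (Finset.univ.image x) := by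
  have hc : (Finset.univ.image x).card = n + 1 := by
    rw [Finset.card_image_of_injective _ hx, Finset.card_univ, Fintype.card_fin]
  have hsum := sum_HL_erase t lam (Finset.univ.image x)
  rw [hc] at hsum
  rw [symmSum_succ, normFactor_succ ht h, mul_assoc, ← hsum,
    Finset.sum_image hx.injOn, Finset.mul_sum]
  refine Finset.sum_congr rfl fun p _ => ?_
  have hx' : Function.Injective fun i : Fin n => x (Equiv.swap 0 p i.succ) :=
    hx.comp ((Equiv.swap 0 p).injective.comp (Fin.succ_injective n))
  have h0 : lam.rowLen (Fin.rev (0 : Fin (n + 1))) = 0 := rowLen_eq_zero.2 (by simpa using h)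
  have h1 : (fun i : Fin n => lam.rowLen (Fin.rev i.succ)) =
      fun i : Fin n => lam.rowLen (Fin.rev i) := by
    ext i
    congr 1
    simp only [Fin.val_rev, Fin.val_succ]
    omega
  have h2 : ∏ i : Fin n, (x (Equiv.swap 0 p i.succ) - t * x p) /
      (x (Equiv.swap 0 p i.succ) - x p) = cross t ((Finset.univ.image x).erase (x p)) {x p} := by
    rw [← image_swap_succ hx, cross, Finset.prod_image hx'.injOn]
    simp only [Finset.prod_singleton]
  rw [h0, h1, h2, ih _ hx', image_swap_succ hx, pow_zero]
  ring

/-- The symmetrization formula satisfies the recursion over columns that defines `HL`. -/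
theorem symmSum_eq {t : ℝ} (ht : t < 1) (lam : YoungDiagram) {n : ℕ} (h : len lam ≤ n)
    (x : Fin n → ℝ) (hx : Function.Injective x) :
    symmSum t x (fun i => lam.rowLen (Fin.rev i)) =
      normFactor t lam n * HL t lam (Finset.univ.image x) := by
  induction lam using column_induction generalizing n with
  | bot =>
    induction n with
    | zero =>
      have : (⊥ : YoungDiagram).rowLen 0 = 0 := rowLen_eq_zero.2 len_bot.le
      simp [symmSum, normFactor, this, rowMult, vFactor, HL_bot]
    | succ n ih =>
      have h0 : len ⊥ ≤ n := len_bot.le.trans n.zero_le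
      exact symmSum_eq_succ ht h0 (ih h0) x hx
  | step lam hl ihl =>
    induction n, h using Nat.le_induction with
    | base =>
      have hc : (Finset.univ.image x).card = len lam := by
        rw [Finset.card_image_of_injective _ hx, Finset.card_univ, Fintype.card_fin]
      have he : (fun i : Fin (len lam) => lam.rowLen (Fin.rev i)) =
          fun i : Fin (len lam) => (dropCol lam).rowLen (Fin.rev i) + 1 := by
        ext i
        have : lam.rowLen (Fin.rev i) ≠ 0 := fun h =>
          absurd (rowLen_eq_zero.1 h) (not_le.2 (Fin.rev i).isLt)
        rw [rowLen_dropCol]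
        omega
      rw [he, symmSum_add_one, ihl (len_dropCol_le lam) x hx, HL_of_card_eq hc,
        normFactor_len t hl, Finset.prod_image hx.injOn]
      ring
    | succ n h ih => exact symmSum_eq_succ ht h ih x hx

theorem hallLittlewoodP_eq {t : ℝ} (ht : t ∈ Set.Ico (0 : ℝ) 1) {n : ℕ} (x : Fin n → ℝ)
    (hx : Function.Injective x) (lam : YoungDiagram) :
    hallLittlewoodP t x lam = HL t lam (Finset.univ.image x) := by
  rw [hallLittlewoodP]
  split_ifs with h
  · rw [HL_eq_zero]
    rwa [Finset.card_image_of_injective _ hx, Finset.card_univ, Fintype.card_fin]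
  · rw [← symmSum_rev t x fun i => lam.rowLen i, symmSum_eq ht.2 lam (not_lt.1 h) x hx]
    exact inv_mul_cancel_left₀ (normFactor_pos ht lam n).ne' _

/-! ### Uniqueness of the expansion in Hall–Littlewood polynomials -/

/-- The skew functions are polynomials in `y`, and at `y = 0` only `P_{lam/lam} = 1` remains. -/
theorem continuous_linearCombination_skewComb (t : ℝ) (lam : YoungDiagram)
    (f : YoungDiagram → ℝ) :
    Continuous (fun y => Finsupp.linearCombination ℝ f (skewComb t y lam)) ∧
      Finsupp.linearCombination ℝ f (skewComb t 0 lam) = f lam := by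
  induction lam using column_induction generalizing f with
  | bot => simp [skewComb_bot, continuous_const]
  | step lam hl ih =>
    have e : ∀ y, Finsupp.linearCombination ℝ f (skewComb t y lam) =
        Finsupp.linearCombination ℝ (fun nu =>
          stayWeight t (len lam) (len (dropCol lam)) (len nu) * f (addCol (len lam) nu))
          (skewComb t y (dropCol lam)) +
        y * Finsupp.linearCombination ℝ (fun nu =>
          moveWeight 1 (len lam) (len nu) * f (addCol (len lam - 1) nu))
          (skewComb t y (dropCol lam)) := fun y => by
      rw [linearCombination_skewComb]
      simp only [Finsupp.linearCombination_apply, Finsupp.sum, Finset.mul_sum]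
      rw [← Finset.sum_add_distrib]
      refine Finset.sum_congr rfl fun nu _ => ?_
      have : moveWeight y (len lam) (len nu) = y * moveWeight 1 (len lam) (len nu) := by
        simp [moveWeight]
      rw [this, smul_eq_mul, smul_eq_mul, smul_eq_mul]
      ring
    simp only [e]
    refine ⟨((ih _).1).add (continuous_id.mul (ih _).1), ?_⟩
    rw [(ih _).2, zero_mul, add_zero, stayWeight, if_pos rfl, one_mul, addCol_dropCol]

/-- Stability: Hall–Littlewood polynomials are compatible with a variable tending to `0`. -/
theorem tendsto_HL_insert (t : ℝ) (lam : YoungDiagram) {S : Finset ℝ} (hS : (0 : ℝ) ∉ S) :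
    Filter.Tendsto (fun y => HL t lam (insert y S)) (nhdsWithin 0 (Set.Ioi 0))
      (nhds (HL t lam S)) := by
  obtain ⟨h1, h2⟩ := continuous_linearCombination_skewComb t lam fun mu => HL t mu S
  rw [← h2]
  refine ((h1.tendsto 0).mono_left nhdsWithin_le_nhds).congr' ?_
  have : ∀ᶠ y : ℝ in nhds 0, y ∉ S := S.finite_toSet.isClosed.isOpen_compl.mem_nhds hS
  filter_upwards [nhdsWithin_le_nhds this] with y hy
  exact (HL_insert t y lam S hy).symm

/-- Hall–Littlewood polynomials of partitions of length at most `N` in `N` variables are linearly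
independent, as functions on the sets of `N` numbers in `(0, r)`. -/
theorem eq_zero_of_linearCombination_HL {t r : ℝ} (hr : 0 < r) (K N : ℕ) (d : YoungDiagram →₀ ℝ)
    (hK : ∀ mu ∈ d.support, mu.card ≤ K) (hN : ∀ mu ∈ d.support, len mu ≤ N)
    (h : ∀ S : Finset ℝ, S.card = N → (S : Set ℝ) ⊆ Set.Ioo 0 r →
      Finsupp.linearCombination ℝ (fun mu => HL t mu S) d = 0) : d = 0 := by
  -- A combination of the empty partition alone is constant.
  have hbot : ∀ (N : ℕ) (d : YoungDiagram →₀ ℝ), (∀ mu ∈ d.support, mu = ⊥) →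
      (∀ S : Finset ℝ, S.card = N → (S : Set ℝ) ⊆ Set.Ioo 0 r →
        Finsupp.linearCombination ℝ (fun mu => HL t mu S) d = 0) → d = 0 := by
    intro N d hd h
    obtain ⟨S, hS, hSc⟩ := (Set.Ioo_infinite hr).exists_subset_card_eq N
    have h0 := h S hSc hS
    rw [Finsupp.linearCombination_apply, Finsupp.sum_of_support_subset (s := {⊥}) _
      (fun mu hmu => Finset.mem_singleton.2 (hd mu hmu)) _ (by simp), Finset.sum_singleton, HL_bot,
      smul_eq_mul, mul_one] at h0
    ext mu
    by_contra hmu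
    rw [hd mu (Finsupp.mem_support_iff.2 hmu)] at hmu
    exact hmu h0
  induction K generalizing N d with
  | zero =>
    refine hbot N d (fun mu hmu => len_eq_zero.1 ?_) h
    have := card_eq_len_add mu
    have := hK mu hmu
    omega
  | succ K ihK =>
    induction N generalizing d with
    | zero => exact hbot 0 d (fun mu hmu => len_eq_zero.1 (Nat.le_zero.1 (hN mu hmu))) h
    | succ N ihN =>
      -- The terms of length at most `N` cancel, as one of the variables tends to `0`.
      have h1 : d.filter (fun mu => len mu ≤ N) = 0 := by
        refine ihN _ (fun mu hmu => ?_) (fun mu hmu => ?_) fun S hSc hS => ?_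
        · exact hK mu (Finset.mem_of_mem_filter mu hmu)
        · exact (Finset.mem_filter.1 hmu).2
        · have h0 : (0 : ℝ) ∉ S := fun h0 => lt_irrefl _ (hS h0).1
          have hl : Filter.Tendsto (fun y => Finsupp.linearCombination ℝ
              (fun mu => HL t mu (insert y S)) d) (nhdsWithin 0 (Set.Ioi 0))
              (nhds (Finsupp.linearCombination ℝ (fun mu => HL t mu S) d)) := by
            simp only [Finsupp.linearCombination_apply, Finsupp.sum]
            exact tendsto_finsetSum _ fun mu _ => (tendsto_HL_insert t mu h0).const_smul _
          have hl' : Filter.Tendsto (fun y => Finsupp.linearCombination ℝ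
              (fun mu => HL t mu (insert y S)) d) (nhdsWithin 0 (Set.Ioi 0)) (nhds 0) := by
            refine tendsto_const_nhds.congr' ?_
            have : ∀ᶠ y : ℝ in nhds 0, y ∉ S := S.finite_toSet.isClosed.isOpen_compl.mem_nhds h0
            filter_upwards [nhdsWithin_le_nhds this, Ioo_mem_nhdsGT hr] with y hy hyr
            refine (h _ (by rw [Finset.card_insert_of_notMem hy, hSc]) ?_).symm
            rw [Finset.coe_insert]
            exact Set.insert_subset hyr hS
          rw [← tendsto_nhds_unique hl hl', Finsupp.linearCombination_apply,
            Finsupp.linearCombination_apply, Finsupp.sum_filter_index, Finsupp.sum,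
            Finsupp.support_filter]
          refine Finset.sum_subset (Finset.filter_subset _ _) fun mu hmu hmu' => ?_
          have : ¬ len mu ≤ N := fun hle => hmu' (Finset.mem_filter.2 ⟨hmu, hle⟩)
          rw [HL_eq_zero (by omega), smul_zero]
      have hlen : ∀ mu ∈ d.support, len mu = N + 1 := fun mu hmu => by
        refine le_antisymm (hN mu hmu) (Nat.lt_of_not_le fun hle => ?_)
        have := DFunLike.congr_fun h1 mu
        rw [Finsupp.filter_apply_pos (fun mu => len mu ≤ N) d hle] at this
        exact Finsupp.mem_support_iff.1 hmu this
      -- All remaining terms are divisible by the product of the variables.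
      have inj : Set.InjOn dropCol (d.support : Set YoungDiagram) := fun mu hmu mu' hmu' he => by
        rw [← addCol_dropCol mu, ← addCol_dropCol mu', he, hlen mu hmu, hlen mu' hmu']
      have h2 : d.mapDomain dropCol = 0 := by
        classical
        have hsup : ∀ nu ∈ (d.mapDomain dropCol).support, ∃ mu ∈ d.support, dropCol mu = nu :=
          fun nu hnu => Finset.mem_image.1 (Finsupp.mapDomain_support hnu)
        refine ihK (N + 1) _ (fun nu hnu => ?_) (fun nu hnu => ?_) fun S hSc hS => ?_
        · obtain ⟨mu, hmu, rfl⟩ := hsup nu hnu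
          have := card_eq_len_add mu
          have := hK mu hmu
          have := hlen mu hmu
          omega
        · obtain ⟨mu, hmu, rfl⟩ := hsup nu hnu
          exact (len_dropCol_le mu).trans (hN mu hmu)
        · have hp : (∏ x ∈ S, x) ≠ 0 := Finset.prod_ne_zero_iff.2 fun x hx => (hS hx).1.ne'
          have h0 := h S hSc hS
          refine mul_left_cancel₀ hp ?_
          rw [mul_zero, ← h0, Finsupp.linearCombination_mapDomain, Finsupp.linearCombination_apply,
            Finsupp.linearCombination_apply, Finsupp.sum, Finsupp.sum, Finset.mul_sum]
          refine Finset.sum_congr rfl fun mu hmu => ?_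
          rw [HL_of_card_eq (hSc.trans (hlen mu hmu).symm), Function.comp_apply, smul_eq_mul,
            smul_eq_mul]
          ring
      refine Finsupp.mapDomain_injOn _ inj (Set.mem_ofPred_eq ▸ subset_rfl) (by simp) ?_
      rw [h2, Finsupp.mapDomain_zero]

theorem image_cons {N : ℕ} (z : ℝ) (x : Fin N → ℝ) :
    Finset.univ.image (Fin.cons z x : Fin (N + 1) → ℝ) = insert z (Finset.univ.image x) := by
  ext y
  simp [Fin.exists_fin_succ, eq_comm]

theorem isSkewExpansion_skewComb {t : ℝ} (ht : t ∈ Set.Ico (0 : ℝ) 1) (z : ℝ)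
    (lam : YoungDiagram) :
    IsSkewExpansion t z lam (skewComb t z lam) := by
  intro N x hx
  obtain ⟨hz, hx'⟩ := Fin.cons_injective_iff.1 hx
  rw [hallLittlewoodP_eq ht _ hx, image_cons, HL_insert _ _ _ _ (by simpa using hz),
    Finsupp.linearCombination_apply]
  simp only [hallLittlewoodP_eq ht _ hx', smul_eq_mul]

theorem isSkewExpansion_unique {t z : ℝ} (ht : t ∈ Set.Ico (0 : ℝ) 1) (hz : 0 < z)
    {lam : YoungDiagram} {c : YoungDiagram →₀ ℝ} (hc : IsSkewExpansion t z lam c) :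
    c = skewComb t z lam := by
  rw [← sub_eq_zero]
  set d := c - skewComb t z lam with hd
  refine eq_zero_of_linearCombination_HL (t := t) hz (d.support.sup YoungDiagram.card)
    (d.support.sup len) d (fun mu hmu => Finset.le_sup (f := YoungDiagram.card) hmu)
    (fun mu hmu => Finset.le_sup (f := len) hmu) fun S hSc hS => ?_
  obtain ⟨n, x, hx, rfl⟩ : ∃ n, ∃ x : Fin n → ℝ, Function.Injective x ∧ Finset.univ.image x = S :=
    ⟨S.card, S.orderEmbOfFin rfl, (S.orderEmbOfFin rfl).injective, by simp⟩
  have hzx : z ∉ Set.range x := fun h => by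
    obtain ⟨i, rfl⟩ := h
    exact lt_irrefl _ (hS (Finset.mem_coe.2 (Finset.mem_image_of_mem x (Finset.mem_univ i)))).2
  have hinj := Fin.cons_injective_iff.2 ⟨hzx, hx⟩
  have h1 := hc _ x hinj
  rw [isSkewExpansion_skewComb ht z lam _ x hinj] at h1
  simp only [hallLittlewoodP_eq ht _ hx] at h1
  rw [hd, map_sub, sub_eq_zero, Finsupp.linearCombination_apply, Finsupp.linearCombination_apply]
  exact h1.symm

theorem skewP_eq {t z : ℝ} (ht : t ∈ Set.Ico (0 : ℝ) 1) (hz : 0 < z) (lam mu : YoungDiagram) :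
    skewP t lam mu z = skewComb t z lam mu := by
  have h : ∃ c : YoungDiagram →₀ ℝ, IsSkewExpansion t z lam c :=
    ⟨_, isSkewExpansion_skewComb ht z lam⟩
  rw [skewP, dif_pos h, isSkewExpansion_unique ht hz h.choose_spec]

/-! ### The even leg coefficient, column by column -/

theorem leg_eq (lam : YoungDiagram) (i j : ℕ) : leg lam (i, j) = lam.colLen j - 1 - i := by
  have : (lam.cells.filter fun d => d.2 = j ∧ i < d.1) =
      (Finset.Ioo i (lam.colLen j)).image fun k => (k, j) := by
    ext ⟨k, l⟩
    simp only [Finset.mem_filter, YoungDiagram.mem_cells, YoungDiagram.mem_iff_lt_colLen,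
      Finset.mem_image, Finset.mem_Ioo, Prod.mk.injEq]
    constructor
    · rintro ⟨h, rfl, h'⟩
      exact ⟨k, ⟨h', h⟩, rfl, rfl⟩
    · rintro ⟨k', ⟨h, h'⟩, rfl, rfl⟩
      exact ⟨h', rfl, h⟩
  rw [leg, this, Finset.card_image_of_injective _ fun a b h => (Prod.mk.inj h).1, Nat.card_Ioo]
  omega

theorem arm_eq (lam : YoungDiagram) (i j : ℕ) : arm lam (i, j) = lam.rowLen i - 1 - j := by
  have : (lam.cells.filter fun d => d.1 = i ∧ j < d.2) =
      (Finset.Ioo j (lam.rowLen i)).image fun k => (i, k) := by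
    ext ⟨k, l⟩
    simp only [Finset.mem_filter, YoungDiagram.mem_cells, YoungDiagram.mem_iff_lt_rowLen,
      Finset.mem_image, Finset.mem_Ioo, Prod.mk.injEq]
    constructor
    · rintro ⟨h, rfl, h'⟩
      exact ⟨l, ⟨h', h⟩, rfl, rfl⟩
    · rintro ⟨k', ⟨h, h'⟩, rfl, rfl⟩
      exact ⟨h', rfl, h⟩
  rw [arm, this, Finset.card_image_of_injective _ fun a b h => (Prod.mk.inj h).2, Nat.card_Ioo]
  omega

theorem prod_cells (lam : YoungDiagram) (f : ℕ × ℕ → ℝ) :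
    ∏ c ∈ lam.cells, f c =
      (∏ i ∈ Finset.range (len lam), f (i, 0)) * ∏ c ∈ (dropCol lam).cells, f (c.1, c.2 + 1) := by
  have h : lam.cells = (addCol (len lam) (dropCol lam)).cells := by rw [addCol_dropCol]
  rw [h]
  simp only [addCol]
  rw [Finset.prod_union, Finset.prod_image, Finset.prod_image, max_eq_left (len_dropCol_le lam)]
  · rintro ⟨a, b⟩ - ⟨c, d⟩ - h
    simp only [Prod.mk.injEq, Nat.add_right_cancel_iff] at h
    exact Prod.ext h.1 h.2
  · exact fun a _ b _ h => (Prod.mk.inj h).1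
  · rw [Finset.disjoint_left]
    simp

/-- The contribution to `bEl` at `q = 0` of `m` rows of equal length, which comes from their last
cells: all cells of positive arm length contribute `1`. -/
noncomputable def evenProd (t : ℝ) (m : ℕ) : ℝ :=
  ∏ k ∈ Finset.range m, if Even k then 1 - t ^ (k + 1) else 1

theorem bEl_zero_eq (t : ℝ) (lam : YoungDiagram) :
    bEl 0 t lam = evenProd t (len lam - len (dropCol lam)) * bEl 0 t (dropCol lam) := by
  rw [bEl, bEl, Finset.prod_filter, Finset.prod_filter, prod_cells]
  congr 1
  · rw [← Finset.prod_range_reflect, evenProd]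
    have hle := len_dropCol_le lam
    refine (Finset.prod_subset 
      (Finset.range_subset_range.2 (Nat.sub_le _ (len (dropCol lam)))) ?_).symm.trans ?_
    · intro k hk hk'
      rw [Finset.mem_range] at hk hk'
      -- These rows have length at least `2`, so that their first cell has positive arm length.
      have hrow : (dropCol lam).rowLen (len lam - 1 - k) ≠ 0 := fun h => by
        have := rowLen_eq_zero.1 h
        omega
      rw [rowLen_dropCol] at hrow
      have harm : lam.rowLen (len lam - 1 - k) - 1 - 0 ≠ 0 := by omega
      rw [arm_eq, zero_pow harm, zero_pow (Nat.succ_ne_zero _)]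
      simp
    · refine Finset.prod_congr rfl fun k hk => ?_
      rw [Finset.mem_range] at hk
      have hrow : (dropCol lam).rowLen (len lam - 1 - k) = 0 := rowLen_eq_zero.2 (by omega)
      rw [rowLen_dropCol] at hrow
      have hleg : leg lam (len lam - 1 - k, 0) = k := by
        rw [leg_eq]
        change len lam - 1 - (len lam - 1 - k) = k
        omega
      rw [hleg, arm_eq, hrow]
      simp
  · refine Finset.prod_congr rfl fun c _ => ?_
    obtain ⟨i, j⟩ := c
    have h1 : leg lam (i, j + 1) = leg (dropCol lam) (i, j) := by
      rw [leg_eq, leg_eq, colLen_dropCol]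
    have h2 : arm lam (i, j + 1) = arm (dropCol lam) (i, j) := by
      rw [arm_eq, arm_eq, rowLen_dropCol]
      omega
    simp only [h1, h2]

theorem transposeEven_iff (lam : YoungDiagram) :
    TransposeEven lam ↔ Even (len lam) ∧ TransposeEven (dropCol lam) := by
  simp only [TransposeEven, colLen_dropCol]
  constructor
  · exact fun h => ⟨h 0, fun j => h (j + 1)⟩
  · rintro ⟨h, h'⟩ (_ | j)
    exacts [h, h' j]

theorem transposeEven_bot : TransposeEven ⊥ := by
  intro j
  have : (⊥ : YoungDiagram).colLen j = 0 :=
    Nat.le_zero.1 (((⊥ : YoungDiagram).colLen_anti 0 j j.zero_le).trans len_bot.le)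
  rw [this]
  exact Even.zero

/-- The boundary weight of `m` rows of equal length, which is zero unless `m` is even. -/
noncomputable def endWeight (t : ℝ) (m : ℕ) : ℝ := if Even m then evenProd t m else 0

theorem endWeight_zero (t : ℝ) : endWeight t 0 = 1 := by simp [endWeight, evenProd]

theorem endWeight_add_two (t : ℝ) (m : ℕ) :
    endWeight t (m + 2) = (1 - t ^ (m + 1)) * endWeight t m := by
  by_cases h : Even m
  · rw [endWeight, endWeight, if_pos h, if_pos (h.add even_two), evenProd,
      Finset.prod_range_succ, Finset.prod_range_succ, if_pos h,
      if_neg (by simpa [Nat.even_add_one] using h), ← evenProd]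
    ring
  · rw [endWeight, endWeight, if_neg h, if_neg (by simpa [Nat.even_add] using h), mul_zero]

theorem endWeight_one (t : ℝ) : endWeight t 1 = 0 := by simp [endWeight]

open Classical in
/-- The factor of the half-space process that depends on the last partition. -/
noncomputable def evenWeight (t : ℝ) (lam : YoungDiagram) : ℝ :=
  bEl 0 t lam * if TransposeEven lam then 1 else 0

theorem evenWeight_bot (t : ℝ) : evenWeight t ⊥ = 1 := by
  simp [evenWeight, transposeEven_bot, bEl]

theorem evenWeight_eq (t : ℝ) (lam : YoungDiagram) :
    evenWeight t lam =
      endWeight t (len lam - len (dropCol lam)) * evenWeight t (dropCol lam) := by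
  have hle := len_dropCol_le lam
  rw [evenWeight, evenWeight, endWeight, bEl_zero_eq t lam]
  by_cases h : TransposeEven (dropCol lam)
  · have h' : Even (len (dropCol lam)) := h 0
    have : TransposeEven lam ↔ Even (len lam - len (dropCol lam)) := by
      rw [transposeEven_iff, Nat.even_sub hle]
      tauto
    simp only [this, h]
    split_ifs <;> ring
  · have : ¬ TransposeEven lam := fun h' => h ((transposeEven_iff lam).1 h').2
    simp [h, this]

theorem endWeight_nonneg {t : ℝ} (ht : t ∈ Set.Ico (0 : ℝ) 1) (m : ℕ) : 0 ≤ endWeight t m := by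
  rw [endWeight]
  split_ifs
  · refine Finset.prod_nonneg fun k _ => ?_
    split_ifs
    · exact sub_nonneg.2 (pow_le_one₀ ht.1 ht.2.le)
    · exact zero_le_one
  · exact le_rfl

theorem evenWeight_nonneg {t : ℝ} (ht : t ∈ Set.Ico (0 : ℝ) 1) (lam : YoungDiagram) :
    0 ≤ evenWeight t lam := by
  induction lam using column_induction with
  | bot => rw [evenWeight_bot]; exact zero_le_one
  | step lam _ ih => rw [evenWeight_eq]; exact mul_nonneg (endWeight_nonneg ht _) ih

theorem skewComb_nonneg {t z : ℝ} (ht : t ∈ Set.Ico (0 : ℝ) 1) (hz : 0 < z)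
    (lam mu : YoungDiagram) : 0 ≤ skewComb t z lam mu := by
  classical
  induction lam using column_induction generalizing mu with
  | bot =>
    rw [skewComb_bot, Finsupp.single_apply]
    split_ifs
    exacts [zero_le_one, le_rfl]
  | step lam _ ih =>
    rw [skewComb_apply]
    refine mul_nonneg ?_ (ih _)
    rw [stayWeight]
    split_ifs
    exacts [zero_le_one, sub_nonneg.2 (pow_le_one₀ ht.1 ht.2.le), hz.le, le_rfl]

/-! ### Sums over strings -/

theorem sum_cons {n : ℕ} (f : (Fin (n + 1) → Bool) → ℝ) :
    ∑ s, f s = ∑ b : Bool, ∑ s : Fin n → Bool, f (Fin.cons b s) := by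
  rw [← (Fin.consEquiv fun _ : Fin (n + 1) => Bool).sum_comp, Fintype.sum_prod_type]
  rfl

theorem sum_snoc {n : ℕ} (f : (Fin (n + 1) → Bool) → ℝ) :
    ∑ s, f s = ∑ s : Fin n → Bool, ∑ b : Bool, f (Fin.snoc (α := fun _ => Bool) s b) := by
  rw [← (Fin.snocEquiv fun _ : Fin (n + 1) => Bool).sum_comp, Fintype.sum_prod_type,
    Finset.sum_comm]
  rfl

/-! ### The column transfer matrix and the rows of the six-vertex model -/

/-- The weight of one step of the transfer from one column of the partitions to the next: `m` is the
difference of the lengths of the two columns, `s` and `s'` are their increments. -/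
noncomputable def stepWeight (t z : ℝ) (m : ℕ) (s s' : Bool) : ℝ :=
  (if s then z else 1) * if s = false ∧ s' = true then 1 - t ^ m else 1

/-- The transfer matrix between two consecutive columns of a sequence of partitions, whose
increments are `s` and `s'`; `m` is the initial difference of lengths, and `f` weighs the final one.
The subtraction of natural numbers never truncates in a term of non-zero weight. -/
noncomputable def transfer (t : ℝ) (f : ℕ → ℝ) :
    (n : ℕ) → (a : ℕ → ℝ) → (m : ℕ) → (s s' : Fin n → Bool) → ℝ
  | 0, _, m, _, _ => f m
  | n + 1, a, m, s, s' => stepWeight t (a 0) m (s 0) (s' 0) *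
      transfer t f n (fun i => a (i + 1)) (m + (s 0).toNat - (s' 0).toNat) (Fin.tail s)
        (Fin.tail s')

/-- The transfer matrix is defined by splitting off the first letters of the strings; one may as well
split off the last ones. -/
theorem transfer_snoc (t : ℝ) (f : ℕ → ℝ) (n : ℕ) (a : ℕ → ℝ) (m : ℕ) (s s' : Fin (n + 1) → Bool) :
    transfer t f (n + 1) a m s s' =
      transfer t (fun m => stepWeight t (a n) m (s (Fin.last n)) (s' (Fin.last n)) *
        f (m + (s (Fin.last n)).toNat - (s' (Fin.last n)).toNat)) n a m (Fin.init s) (Fin.init s') := by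
  induction n generalizing a m with
  | zero => rfl
  | succ n ih =>
    rw [transfer, ih, transfer]
    rfl

/-- The probability that a bulk vertex with parameter `u`, and incoming edges `h` (west) and `r`
(south), has its north edge in state `s`. -/
noncomputable def vertexWeight (t u : ℝ) : (h r s : Bool) → ℝ
  | false, false, s => if s then 0 else 1
  | true, true, s => if s then 1 else 0
  | true, false, s => if s then (1 - t) * u / (1 - t * u) else (1 - u) / (1 - t * u)
  | false, true, s => if s then t * (1 - u) / (1 - t * u) else (1 - t) / (1 - t * u)

/-- The probability that a row of bulk vertices, with the path string `r` below it and the west edge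
`h`, has the path string `s` above it, weighted with `g` of its last east edge. The east edge of a
vertex is found from its other edges by conservation of paths. -/
noncomputable def rowWeight (t b : ℝ) (g : Bool → ℝ) :
    (n : ℕ) → (a : ℕ → ℝ) → (h : Bool) → (r s : Fin n → Bool) → ℝ
  | 0, _, h, _, _ => g h
  | n + 1, a, h, r, s => vertexWeight t (a 0 * b) h (r 0) (s 0) *
      rowWeight t b g n (fun i => a (i + 1)) (h ^^ r 0 ^^ s 0) (Fin.tail r) (Fin.tail s)

/-- The distribution of the path string, row by row: a path enters from the west, and the corner
turns the last east edge into its complement. -/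
noncomputable def stringProb (t : ℝ) (a : ℕ → ℝ) : (n : ℕ) → (Fin n → Bool) → ℝ
  | 0, _ => 1
  | n + 1, s => ∑ r : Fin n → Bool, stringProb t a n r *
      rowWeight t (a n) (fun h => if s (Fin.last n) = !h then 1 else 0) n a true r (Fin.init s)

/-! ### The Yang–Baxter and reflection equations -/

/-- One column with the transfer line above the row of the six-vertex model. -/
noncomputable def columnAbove (t z b : ℝ) (s r : Bool) (f : ℕ → Bool → ℝ) (m : ℕ) (h : Bool) : ℝ :=
  ∑ s' : Bool, stepWeight t z m s s' * vertexWeight t (z * b) h r s' *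
    f (m + s.toNat - s'.toNat) (h ^^ r ^^ s')

/-- One column with the transfer line below the row of the six-vertex model. -/
noncomputable def columnBelow (t z b : ℝ) (s r : Bool) (f : ℕ → Bool → ℝ) (m : ℕ) (h : Bool) : ℝ :=
  ∑ r' : Bool, stepWeight t z m r' r * vertexWeight t (z * b) h r' s *
    f (m + r'.toNat - r.toNat) (h ^^ r' ^^ s)

/-- The crossing of the transfer line with the row of the six-vertex model. The sum of the counter
`m` and the number of holes `!h` is conserved. The truncated `m - 1` at `m = 0` has weight `0`. -/
noncomputable def crossing (t b : ℝ) (f : ℕ → Bool → ℝ) (m : ℕ) (h : Bool) : ℝ :=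
  if h then f m true + b * (1 - t ^ m) * f (m - 1) false else f (m + 1) true + b * f m false

/-- The Yang–Baxter equation: the crossing can be moved through a column. -/
theorem yang_baxter {t z b : ℝ} (hu : 1 - t * (z * b) ≠ 0) (s r : Bool) (f : ℕ → Bool → ℝ)
    (m : ℕ) (h : Bool) :
    columnAbove t z b s r (crossing t b f) m h = crossing t b (columnBelow t z b s r f) m h := by
  simp only [columnAbove, columnBelow, crossing, stepWeight, vertexWeight, Fintype.sum_bool]
  obtain ⟨d, hd⟩ : ∃ d, d = 1 - t * (z * b) := ⟨_, rfl⟩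
  rw [← hd] at hu
  rcases m with _ | m <;> cases s <;> cases r <;> cases h <;>
  simp [← hd] <;> field_simp <;> (try rw [hd]) <;> ring

/-- The reflection equation: at the corner, where the row turns upwards, the crossing disappears.
On the right the transfer line meets the vertical part of the row, whose state is `!h`. -/
theorem reflection (t b : ℝ) (s : Bool) (m : ℕ) (h : Bool) :
    crossing t b (fun m h => endWeight t m * if s = !h then 1 else 0) m h =
      stepWeight t b m s (!h) * endWeight t (m + s.toNat - (!h).toNat) := by
  rcases m with _ | m <;> cases s <;> cases h <;>
  simp [crossing, stepWeight, endWeight_zero, endWeight_one, endWeight_add_two]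
  ring

/-- All columns but the last, with the transfer line above the row of the six-vertex model. -/
noncomputable def stripAbove (t b : ℝ) (f : ℕ → Bool → ℝ) :
    (n : ℕ) → (a : ℕ → ℝ) → (s r : Fin n → Bool) → ℕ → Bool → ℝ
  | 0, _, _, _ => f
  | n + 1, a, s, r => columnAbove t (a 0) b (s 0) (r 0)
      (stripAbove t b f n (fun i => a (i + 1)) (Fin.tail s) (Fin.tail r))

/-- All columns but the last, with the transfer line below the row of the six-vertex model. -/
noncomputable def stripBelow (t b : ℝ) (f : ℕ → Bool → ℝ) :
    (n : ℕ) → (a : ℕ → ℝ) → (s r : Fin n → Bool) → ℕ → Bool → ℝ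
  | 0, _, _, _ => f
  | n + 1, a, s, r => columnBelow t (a 0) b (s 0) (r 0)
      (stripBelow t b f n (fun i => a (i + 1)) (Fin.tail s) (Fin.tail r))

theorem strip_crossing {t b : ℝ} {n : ℕ} {a : ℕ → ℝ} (hu : ∀ i, 1 - t * (a i * b) ≠ 0)
    (f : ℕ → Bool → ℝ) (s r : Fin n → Bool) :
    stripAbove t b (crossing t b f) n a s r = crossing t b (stripBelow t b f n a s r) := by
  induction n generalizing a with
  | zero => rfl
  | succ n ih =>
    rw [stripAbove, ih fun i => hu (i + 1), stripBelow]
    ext m h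
    exact yang_baxter (hu 0) _ _ _ m h

theorem sum_transfer_mul_rowWeight (t b : ℝ) (f : Bool → ℕ → ℝ) (g : Bool → Bool → ℝ) (n : ℕ)
    (a : ℕ → ℝ) (s r : Fin n → Bool) (m : ℕ) (h : Bool) :
    ∑ s' : Fin n → Bool, ∑ c : Bool, transfer t (f c) n a m s s' * rowWeight t b (g c) n a h r s' =
      stripAbove t b (fun m h => ∑ c : Bool, f c m * g c h) n a s r m h := by
  induction n generalizing a m h with
  | zero => simp [transfer, rowWeight, stripAbove]
  | succ n ih =>
    rw [sum_cons, stripAbove, columnAbove]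
    refine Finset.sum_congr rfl fun c' _ => ?_
    rw [← ih, Finset.mul_sum]
    refine Finset.sum_congr rfl fun s' _ => ?_
    rw [Finset.mul_sum]
    refine Finset.sum_congr rfl fun c _ => ?_
    rw [transfer, rowWeight, Fin.cons_zero, Fin.tail_cons]
    ring

theorem sum_rowWeight_mul_transfer (t b : ℝ) (f : ℕ → ℝ) (g : Bool → ℝ) (n : ℕ)
    (a : ℕ → ℝ) (s r : Fin n → Bool) (m : ℕ) (h : Bool) :
    ∑ r' : Fin n → Bool, rowWeight t b g n a h r' s * transfer t f n a m r' r =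
      stripBelow t b (fun m h => f m * g h) n a s r m h := by
  induction n generalizing a m h with
  | zero => simp [transfer, rowWeight, stripBelow, mul_comm]
  | succ n ih =>
    rw [sum_cons, stripBelow, columnBelow]
    refine Finset.sum_congr rfl fun c' _ => ?_
    rw [← ih, Finset.mul_sum]
    refine Finset.sum_congr rfl fun s' _ => ?_
    rw [transfer, rowWeight, Fin.cons_zero, Fin.tail_cons]
    ring

/-- The row of the six-vertex model can be moved through the column transfer matrix. -/
theorem exchange {t : ℝ} {n : ℕ} {a : ℕ → ℝ} (hu : ∀ i, 1 - t * (a i * a n) ≠ 0)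
    (s : Fin (n + 1) → Bool) (r : Fin n → Bool) :
    ∑ s' : Fin (n + 1) → Bool, transfer t (endWeight t) (n + 1) a 0 s s' *
        rowWeight t (a n) (fun h => if s' (Fin.last n) = !h then 1 else 0) n a true r
          (Fin.init s') =
      ∑ r' : Fin n → Bool,
        rowWeight t (a n) (fun h => if s (Fin.last n) = !h then 1 else 0) n a true r' (Fin.init s) *
          transfer t (endWeight t) n a 0 r' r := by
  rw [sum_snoc, sum_rowWeight_mul_transfer]
  simp only [transfer_snoc, Fin.init_snoc, Fin.snoc_last]
  rw [sum_transfer_mul_rowWeight t (a n)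
    (fun c m => stepWeight t (a n) m (s (Fin.last n)) c *
      endWeight t (m + (s (Fin.last n)).toNat - c.toNat))
    (fun c h => if c = !h then 1 else 0)]
  have h1 : (fun (m : ℕ) (h : Bool) => ∑ c : Bool, stepWeight t (a n) m (s (Fin.last n)) c *
      endWeight t (m + (s (Fin.last n)).toNat - c.toNat) * if c = !h then 1 else 0) =
      crossing t (a n) fun m h => endWeight t m * if s (Fin.last n) = !h then 1 else 0 := by
    ext m h
    rw [reflection]
    simp
  -- At the left end `m = 0` and the row is occupied, so that the crossing is trivial.
  rw [h1, strip_crossing hu]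
  simp [crossing]

/-- The law of the path string is invariant under the column transfer matrix. -/
theorem stringProb_eq_sum_transfer {t : ℝ} {a : ℕ → ℝ} (hu : ∀ i j, 1 - t * (a i * a j) ≠ 0)
    (n : ℕ) (s : Fin n → Bool) :
    stringProb t a n s =
      ∑ s' : Fin n → Bool, transfer t (endWeight t) n a 0 s s' * stringProb t a n s' := by
  induction n with
  | zero => simp [stringProb, transfer, endWeight_zero]
  | succ n ih =>
    have h1 : ∀ s' : Fin (n + 1) → Bool,
        transfer t (endWeight t) (n + 1) a 0 s s' * stringProb t a (n + 1) s' =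
        ∑ r : Fin n → Bool, stringProb t a n r * (transfer t (endWeight t) (n + 1) a 0 s s' *
          rowWeight t (a n) (fun h => if s' (Fin.last n) = !h then 1 else 0) n a true r
            (Fin.init s')) := fun s' => by
      rw [stringProb, Finset.mul_sum]
      exact Finset.sum_congr rfl fun r _ => by ring
    simp only [h1]
    rw [Finset.sum_comm]
    simp only [← Finset.mul_sum, exchange fun i => hu i n]
    simp only [Finset.mul_sum]
    rw [Finset.sum_comm, stringProb]
    refine Finset.sum_congr rfl fun r' _ => ?_
    rw [ih r', Finset.sum_mul]
    exact Finset.sum_congr rfl fun r _ => by ring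

/-! ### The probability of the empty string -/

/-- The row above which all vertical edges are empty: its path goes straight through. -/
theorem rowWeight_empty (t b : ℝ) (g : Bool → ℝ) (n : ℕ) (a : ℕ → ℝ) (r : Fin n → Bool) :
    rowWeight t b g n a true r (fun _ => false) =
      if r = fun _ => false then
        (∏ i ∈ Finset.range n, (1 - a i * b) / (1 - t * (a i * b))) * g true
      else 0 := by
  induction n generalizing a with
  | zero => simp [rowWeight, Subsingleton.elim r fun _ => false]
  | succ n ih =>
    have hr : r = (fun _ => false) ↔ r 0 = false ∧ Fin.tail r = fun _ => false := by
      constructor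
      · rintro rfl
        exact ⟨rfl, rfl⟩
      · rintro ⟨h0, h1⟩
        rw [← Fin.cons_self_tail r, h0, h1]
        ext i
        refine Fin.cases rfl (fun _ => rfl) i
    rw [rowWeight]
    cases h0 : r 0
    · have e : (Fin.tail fun _ : Fin (n + 1) => false) = fun _ => false := rfl
      simp only [vertexWeight, hr, h0, true_and, e]
      rw [Bool.xor_false, Bool.xor_false, ih, Finset.prod_range_succ']
      simp only [Bool.false_eq_true, if_false]
      split_ifs
      · ring
      · rw [mul_zero]
    · simp [vertexWeight, hr, h0]

theorem Phi_succ (t : ℝ) (a : ℕ → ℝ) (n : ℕ) :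
    Phi t a (n + 1) =
      Phi t a n * ∏ i ∈ Finset.range n, (1 - t * (a i * a n)) / (1 - a i * a n) := by
  have h : ∀ n, Phi t a n = ∏ j ∈ Finset.range n, ∏ i ∈ Finset.range j,
      (1 - t * (a i * a j)) / (1 - a i * a j) := fun n => by
    rw [Phi, Finset.prod_comm' (t' := Finset.univ) (s' := fun j => Finset.Iio j) (by simp),
      ← Fin.prod_univ_eq_prod_range
        fun j => ∏ i ∈ Finset.range j, (1 - t * (a i * a j)) / (1 - a i * a j)]
    refine Finset.prod_congr rfl fun j _ => ?_
    refine Finset.prod_bij (fun i _ => i.val) (fun i hi => ?_) (fun i _ j _ h => Fin.ext h)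
      (fun i hi => ?_) fun i _ => rfl
    · simpa using hi
    · have hij := Finset.mem_range.1 hi
      exact ⟨⟨i, hij.trans j.isLt⟩, Finset.mem_Iio.2 hij, rfl⟩
  rw [h, h, Finset.prod_range_succ]

theorem stringProb_empty (t : ℝ) (a : ℕ → ℝ) (n : ℕ) :
    stringProb t a n (fun _ => false) = (Phi t a n)⁻¹ := by
  induction n with
  | zero => simp [stringProb, Phi]
  | succ n ih =>
    have e : (Fin.init fun _ : Fin (n + 1) => false) = fun _ => false := rfl
    simp only [stringProb, e, rowWeight_empty]
    simp only [mul_ite, mul_zero, Finset.sum_ite_eq', Finset.mem_univ, if_true]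
    rw [ih, Phi_succ, mul_inv, ← Finset.prod_inv_distrib]
    simp

/-! ### The law of the six-vertex model -/

theorem bulkVertex_fst (t u v : ℝ) (h r : Bool) :
    (bulkVertex t u v h r).1 = (h ^^ r ^^ (bulkVertex t u v h r).2) := by
  cases h <;> cases r <;> simp only [bulkVertex] <;> (try split_ifs) <;> rfl

theorem volume_coe_lt {c : ℝ} (h0 : 0 ≤ c) (h1 : c ≤ 1) :
    volume {v : unitInterval | (v : ℝ) < c} = ENNReal.ofReal c :=
  unitInterval.volume_Iio ⟨c, h0, h1⟩

theorem volume_le_coe {c : ℝ} (h0 : 0 ≤ c) (h1 : c ≤ 1) :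
    volume {v : unitInterval | c ≤ (v : ℝ)} = ENNReal.ofReal (1 - c) :=
  unitInterval.volume_Ici ⟨c, h0, h1⟩

/-- The set of outcomes of the random number at a vertex that lead to the state `s` of the north
edge. -/
def vertexSet (t u : ℝ) (h r s : Bool) : Set unitInterval :=
  {v | (bulkVertex t u v h r).2 = s}

theorem measurableSet_vertexSet (t u : ℝ) (h r s : Bool) :
    MeasurableSet (vertexSet t u h r s) := by
  have hc : ∀ c : ℝ, MeasurableSet {v : unitInterval | (v : ℝ) < c} := fun c =>
    measurableSet_lt measurable_subtype_coe measurable_const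
  have hm : ∀ (c : ℝ) (x y : Bool × Bool), MeasurableSet
      {v : unitInterval | (if (v : ℝ) < c then x else y).2 = s} := fun c x y => by
    have : {v : unitInterval | (if (v : ℝ) < c then x else y).2 = s} =
        {v : unitInterval | (v : ℝ) < c}.ite {_v | x.2 = s} {_v | y.2 = s} := by
      ext v
      simp only [Set.ite, Set.mem_ofPred_eq, Set.mem_union, Set.mem_inter_iff, Set.mem_sdiff]
      split_ifs with h <;> simp [h]
    rw [this]
    exact (hc c).ite (.const _) (.const _)
  unfold vertexSet
  cases h <;> cases r <;> simp only [bulkVertex]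
  exacts [.const _, hm _ _ _, hm _ _ _, .const _]

theorem vertexWeight_nonneg {t u : ℝ} (ht : t ∈ Set.Ico (0 : ℝ) 1) (hu : u ∈ Set.Ioo (0 : ℝ) 1)
    (h r s : Bool) : 0 ≤ vertexWeight t u h r s := by
  have h1 : 0 ≤ 1 - t := by linarith [ht.2]
  have h2 : 0 ≤ 1 - u := by linarith [hu.2]
  have h3 : 0 ≤ 1 - t * u := by nlinarith [ht.1, ht.2, hu.1, hu.2]
  have h4 := hu.1.le
  have h5 := ht.1
  cases h <;> cases r <;> cases s <;> simp only [vertexWeight] <;> norm_num <;> positivity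

theorem volume_vertexSet {t u : ℝ} (ht : t ∈ Set.Ico (0 : ℝ) 1) (hu : u ∈ Set.Ioo (0 : ℝ) 1)
    (h r s : Bool) :
    volume (vertexSet t u h r s) = ENNReal.ofReal (vertexWeight t u h r s) := by
  have h3 : 0 < 1 - t * u := by nlinarith [ht.1, ht.2, hu.1, hu.2]
  have hp : 0 ≤ (1 - u) / (1 - t * u) := div_nonneg (by linarith [hu.2]) h3.le
  have hp' : (1 - u) / (1 - t * u) ≤ 1 := (div_le_one h3).2 (by nlinarith [ht.1, ht.2, hu.1, hu.2])
  have hq : 0 ≤ t * (1 - u) / (1 - t * u) := by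
    rw [mul_div_assoc]
    exact mul_nonneg ht.1 hp
  have hq' : t * (1 - u) / (1 - t * u) ≤ 1 := by
    rw [mul_div_assoc]
    exact mul_le_one₀ ht.2.le hp hp'
  have ep : (1 - t) * u / (1 - t * u) = 1 - (1 - u) / (1 - t * u) := by
    field_simp
    ring
  have eq : (1 - t) / (1 - t * u) = 1 - t * (1 - u) / (1 - t * u) := by
    field_simp
    ring
  have hm : ∀ (c : ℝ) (x y : Bool × Bool),
      {v : unitInterval | (if (v : ℝ) < c then x else y).2 = s} =
        if x.2 = s then (if y.2 = s then Set.univ else {v : unitInterval | (v : ℝ) < c})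
        else (if y.2 = s then {v : unitInterval | ¬ (v : ℝ) < c} else ∅) := fun c x y => by
    ext v
    rw [Set.mem_ofPred_eq]
    split_ifs with h1 h2 h3 h2 h3 h3 h3 <;> simp_all
  unfold vertexSet
  cases h <;> cases r <;> simp only [bulkVertex, hm, vertexWeight]
  · cases s <;> simp
  · cases s
    · simp [volume_le_coe hq hq', eq]
    · simp [volume_coe_lt hq hq']
  · cases s
    · simp [volume_coe_lt hp hp']
    · simp [volume_le_coe hp hp', ep]
  · cases s <;> simp

/-- The west edges of a row with first west edge `h` and path strings `r` below and `s` above it. -/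
def rowEdge (h : Bool) (r s : ℕ → Bool) : ℕ → Bool
  | 0 => h
  | x + 1 => (rowEdge h r s x ^^ r x ^^ s x)

theorem rowEdge_succ' (h : Bool) (r s : ℕ → Bool) (x : ℕ) :
    rowEdge h r s (x + 1) =
      rowEdge (h ^^ r 0 ^^ s 0) (fun i => r (i + 1)) (fun i => s (i + 1)) x := by
  induction x with
  | zero => rfl
  | succ x ih => rw [rowEdge, ih, rowEdge]

theorem rowWeight_eq_prod (t b : ℝ) (g : Bool → ℝ) (n : ℕ) (a : ℕ → ℝ) (h : Bool)
    (r s : ℕ → Bool) :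
    rowWeight t b g n a h (fun i => r i) (fun i => s i) =
      (∏ x ∈ Finset.range n, vertexWeight t (a x * b) (rowEdge h r s x) (r x) (s x)) *
        g (rowEdge h r s n) := by
  induction n generalizing a h r s with
  | zero => simp [rowWeight, rowEdge]
  | succ n ih =>
    have e1 : ∀ r : ℕ → Bool, Fin.tail (fun i : Fin (n + 1) => r i) = fun i : Fin n => r (i + 1) :=
      fun r => by
        ext i
        simp [Fin.tail]
    rw [rowWeight, e1, e1, ih _ _ (fun i => r (i + 1)) fun i => s (i + 1), Finset.prod_range_succ',
      rowEdge_succ']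
    simp only [rowEdge_succ', Fin.val_zero]
    rw [rowEdge]
    ring

theorem rowWeight_nonneg {t b : ℝ} {g : Bool → ℝ} {n : ℕ} {a : ℕ → ℝ}
    (ht : t ∈ Set.Ico (0 : ℝ) 1) (ha : ∀ i, a i * b ∈ Set.Ioo (0 : ℝ) 1) (hg : ∀ h, 0 ≤ g h)
    (h : Bool) (r s : Fin n → Bool) : 0 ≤ rowWeight t b g n a h r s := by
  induction n generalizing a h with
  | zero => exact hg h
  | succ n ih =>
    exact mul_nonneg (vertexWeight_nonneg ht (ha 0) _ _ _) (ih (fun i => ha (i + 1)) _ _ _)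

theorem mul_mem_Ioo {a : ℕ → ℝ} (ha : ∀ i, a i ∈ Set.Ioo (0 : ℝ) 1) (i j : ℕ) :
    a i * a j ∈ Set.Ioo (0 : ℝ) 1 :=
  ⟨mul_pos (ha i).1 (ha j).1, mul_lt_one_of_nonneg_of_lt_one_left (ha i).1.le (ha i).2 (ha j).2.le⟩

theorem stringProb_nonneg {t : ℝ} {a : ℕ → ℝ} (ht : t ∈ Set.Ico (0 : ℝ) 1)
    (ha : ∀ i, a i ∈ Set.Ioo (0 : ℝ) 1) (n : ℕ) (s : Fin n → Bool) : 0 ≤ stringProb t a n s := by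
  induction n with
  | zero => exact zero_le_one
  | succ n ih =>
    refine Finset.sum_nonneg fun r _ => mul_nonneg (ih r) ?_
    refine rowWeight_nonneg ht (fun i => mul_mem_Ioo ha i n) (fun h => ?_) _ _ _
    split_ifs
    exacts [zero_le_one, le_rfl]

/-- The event that the path string is `r`. -/
def stringEvent (t : ℝ) (a : ℕ → ℝ) (n : ℕ) (r : ℕ → Bool) : Set Sample :=
  {ω | ∀ k < n, pathsAbove t a ω n k = r k}

/-- In a row with given path string `r` below it, the outcomes with a given path string `s` above
it form a box. -/
theorem row_mem_iff {t : ℝ} {a : ℕ → ℝ} {n : ℕ} {r s south : ℕ → Bool} {ω : Sample} {k : ℕ}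
    (hr : ∀ x < k, south x = r x) :
    ((∀ x < k, (bulkVertex t (a x * a n) (ω (x, n)) (westEdge t a ω n south x) (south x)).2 = s x) ↔
      ∀ x < k, ω (x, n) ∈ vertexSet t (a x * a n) (rowEdge true r s x) (r x) (s x)) ∧
    ((∀ x < k, (bulkVertex t (a x * a n) (ω (x, n)) (westEdge t a ω n south x) (south x)).2 = s x) →
      westEdge t a ω n south k = rowEdge true r s k) := by
  induction k with
  | zero => simp [westEdge, rowEdge]
  | succ k ih =>
    obtain ⟨ih1, ih2⟩ := ih fun x hx => hr x (by omega)
    refine ⟨?_, fun h => ?_⟩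
    · rw [Nat.forall_lt_succ_right, Nat.forall_lt_succ_right, ← ih1]
      refine and_congr_right fun h => ?_
      rw [ih2 h, hr k (by omega)]
      rfl
    · rw [Nat.forall_lt_succ_right] at h
      rw [westEdge, bulkVertex_fst, h.2, ih2 h.1, hr k (by omega), rowEdge]

theorem mem_stringEvent_succ {t : ℝ} {a : ℕ → ℝ} {n : ℕ} {r s : ℕ → Bool} {ω : Sample}
    (hr : ω ∈ stringEvent t a n r) :
    ω ∈ stringEvent t a (n + 1) s ↔
      (∀ x < n, ω (x, n) ∈ vertexSet t (a x * a n) (rowEdge true r s x) (r x) (s x)) ∧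
        s n = !rowEdge true r s n := by
  obtain ⟨h1, h2⟩ := row_mem_iff (t := t) (a := a) (n := n) (s := s) (ω := ω) hr
  rw [stringEvent, Set.mem_ofPred_eq, Nat.forall_lt_succ_right, ← h1]
  have e : (∀ k < n, pathsAbove t a ω (n + 1) k = s k) ↔
      ∀ x < n, (bulkVertex t (a x * a n) (ω (x, n)) (westEdge t a ω n (pathsAbove t a ω n) x)
        (pathsAbove t a ω n x)).2 = s x :=
    forall₂_congr fun k hk => by simp only [pathsAbove, if_pos hk]
  rw [e]
  refine and_congr_right fun h => ?_
  simp only [pathsAbove, lt_irrefl, if_false, if_true, h2 h]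
  exact eq_comm

/-- The extension of a finite string to all natural numbers. -/
def extendString {n : ℕ} (r : Fin n → Bool) (k : ℕ) : Bool :=
  if h : k < n then r ⟨k, h⟩ else false

theorem extendString_coe {n : ℕ} (r : Fin n → Bool) (i : Fin n) : extendString r i = r i := by
  simp [extendString]

theorem rowWeight_congr_string {t b : ℝ} {g : Bool → ℝ} {n : ℕ} {a : ℕ → ℝ} {h : Bool}
    (r s : Fin n → Bool) (s' : ℕ → Bool) (hs : ∀ i : Fin n, s i = s' i) :
    rowWeight t b g n a h r s =
      (∏ x ∈ Finset.range n, vertexWeight t (a x * b) (rowEdge h (extendString r) s' x)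
        (extendString r x) (s' x)) * g (rowEdge h (extendString r) s' n) := by
  rw [← rowWeight_eq_prod]
  congr
  · ext i
    rw [extendString_coe]
  · ext i
    rw [hs]

/-- The law of the path string, jointly with the random numbers in later rows. -/
theorem stringEvent_box {t : ℝ} {a : ℕ → ℝ} (ht : t ∈ Set.Ico (0 : ℝ) 1)
    (ha : ∀ i, a i ∈ Set.Ioo (0 : ℝ) 1) (n : ℕ) (s : Fin n → Bool) :
    MeasurableSet (stringEvent t a n (extendString s)) ∧
    ∀ (J : Finset (ℕ × ℕ)) (A : ℕ × ℕ → Set unitInterval), (∀ j ∈ J, n ≤ j.2) →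
      (∀ j, MeasurableSet (A j)) →
      sampleMeasure (stringEvent t a n (extendString s) ∩ Set.pi J A) =
        ENNReal.ofReal (stringProb t a n s) * ∏ j ∈ J, volume (A j) := by
  induction n with
  | zero =>
    have : stringEvent t a 0 (extendString s) = Set.univ := by simp [stringEvent]
    rw [this]
    refine ⟨.univ, fun J A _ hA => ?_⟩
    rw [Set.univ_inter, sampleMeasure, Measure.infinitePi_pi _ fun j _ => hA j]
    simp [stringProb]
  | succ n ih =>
    set row : Finset (ℕ × ℕ) := (Finset.range n).image fun x => (x, n) with hrow
    -- The outcomes of row `n` that lead from `r` to `s`.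
    let B : (Fin n → Bool) → ℕ × ℕ → Set unitInterval := fun r j =>
      vertexSet t (a j.1 * a n) (rowEdge true (extendString r) (extendString s) j.1)
        (extendString r j.1) (extendString s j.1)
    let good : (Fin n → Bool) → Prop := fun r =>
      extendString s n = !rowEdge true (extendString r) (extendString s) n
    have hdec : stringEvent t a (n + 1) (extendString s) = ⋃ r : Fin n → Bool,
        stringEvent t a n (extendString r) ∩ (Set.pi row (B r) ∩ {_ω | good r}) := by
      ext ω
      rw [Set.mem_iUnion]
      have hbox : ∀ r, (ω ∈ Set.pi row (B r) ↔ ∀ x < n, ω (x, n) ∈ B r (x, n)) := fun r => by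
        simp [Set.mem_pi, hrow]
      constructor
      · intro h
        have hr : ω ∈ stringEvent t a n (extendString fun i : Fin n => pathsAbove t a ω n i) :=
          fun k hk => by simp [extendString, hk]
        refine ⟨_, hr, ?_⟩
        rw [mem_stringEvent_succ hr] at h
        exact ⟨(hbox _).2 h.1, h.2⟩
      · rintro ⟨r, hr, h1, h2⟩
        exact (mem_stringEvent_succ hr).2 ⟨(hbox r).1 h1, h2⟩
    have hBm : ∀ r j, MeasurableSet (B r j) := fun r j => measurableSet_vertexSet _ _ _ _ _
    have hmeas : ∀ r, MeasurableSet (stringEvent t a n (extendString r) ∩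
        (Set.pi row (B r) ∩ {_ω : Sample | good r})) := fun r =>
      (ih r).1.inter ((MeasurableSet.pi row.countable_toSet fun j _ => hBm r j).inter (.const _))
    refine ⟨hdec ▸ MeasurableSet.iUnion hmeas, fun J A hJ hA => ?_⟩
    have hdisj : Disjoint row J := by
      rw [Finset.disjoint_left]
      intro j hj hj'
      obtain ⟨x, -, rfl⟩ := Finset.mem_image.1 hj
      exact absurd (hJ _ hj') (by simp)
    rw [hdec, Set.iUnion_inter, measure_iUnion, tsum_fintype]
    · have hterm : ∀ r, sampleMeasure (stringEvent t a n (extendString r) ∩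
            (Set.pi row (B r) ∩ {_ω : Sample | good r}) ∩ Set.pi J A) =
          ENNReal.ofReal (stringProb t a n r * rowWeight t (a n)
            (fun h => if s (Fin.last n) = !h then 1 else 0) n a true r (Fin.init s)) *
            ∏ j ∈ J, volume (A j) := fun r => by
        rw [rowWeight_congr_string r (Fin.init s) (extendString s) fun i =>
          (extendString_coe s i.castSucc).symm]
        have hlast : s (Fin.last n) = extendString s n := (extendString_coe s (Fin.last n)).symm
        rw [hlast]
        by_cases hg : good r
        · rw [if_pos hg, mul_one]
          classical
          have hset : stringEvent t a n (extendString r) ∩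
              (Set.pi row (B r) ∩ {_ω : Sample | good r}) ∩ Set.pi J A =
              stringEvent t a n (extendString r) ∩
                Set.pi (row ∪ J : Finset (ℕ × ℕ)) fun j => if j ∈ row then B r j else A j := by
            ext ω
            simp only [Set.mem_inter_iff, Set.mem_pi, Set.mem_ofPred_eq, hg, and_true,
              Finset.coe_union, Set.mem_union, Finset.mem_coe, and_assoc]
            refine and_congr_right fun _ => ⟨fun ⟨h1, h2⟩ j hj => ?_, fun h => ⟨fun j hj => ?_,
              fun j hj => ?_⟩⟩
            · by_cases hjr : j ∈ row
              · simpa [hjr] using h1 j hjr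
              · simpa [hjr] using h2 j (hj.resolve_left hjr)
            · simpa [hj] using h j (Or.inl hj)
            · simpa [Finset.disjoint_right.1 hdisj hj] using h j (Or.inr hj)
          rw [hset, (ih r).2 _ _ ?_ ?_, Finset.prod_union hdisj,
            ENNReal.ofReal_mul (stringProb_nonneg ht ha n r),
            ENNReal.ofReal_prod_of_nonneg fun x _ =>
              vertexWeight_nonneg ht (mul_mem_Ioo ha _ _) _ _ _,
            mul_assoc]
          · congr 1
            congr 1
            · rw [hrow, Finset.prod_image fun x _ y _ h => (Prod.mk.inj h).1]
              refine Finset.prod_congr rfl fun x hx => ?_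
              rw [if_pos (Finset.mem_image_of_mem _ hx)]
              exact volume_vertexSet ht (mul_mem_Ioo ha _ _) _ _ _
            · refine Finset.prod_congr rfl fun j hj => ?_
              rw [if_neg (Finset.disjoint_right.1 hdisj hj)]
          · intro j hj
            rcases Finset.mem_union.1 hj with hj | hj
            · obtain ⟨x, -, rfl⟩ := Finset.mem_image.1 hj
              exact le_rfl
            · exact (Nat.le_succ n).trans (hJ j hj)
          · intro j
            split_ifs
            exacts [hBm r j, hA j]
        · rw [if_neg hg, mul_zero, mul_zero, ENNReal.ofReal_zero, zero_mul]
          convert measure_empty (μ := sampleMeasure)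
          simp [hg]
      simp only [hterm]
      rw [← Finset.sum_mul, ← ENNReal.ofReal_sum_of_nonneg, stringProb]
      refine fun r _ => mul_nonneg (stringProb_nonneg ht ha n r) ?_
      refine rowWeight_nonneg ht (fun i => mul_mem_Ioo ha i n) (fun h => ?_) _ _ _
      split_ifs
      exacts [zero_le_one, le_rfl]
    · intro r r' hne
      refine Set.disjoint_left.2 fun ω h h' => hne ?_
      ext i
      have h1 := h.1.1 i i.isLt
      have h2 := h'.1.1 i i.isLt
      rw [extendString_coe] at h1 h2
      rw [← h1, ← h2]
    · exact fun r => (hmeas r).inter (MeasurableSet.pi J.countable_toSet fun j _ => hA j)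

theorem sampleMeasure_stringEvent {t : ℝ} {a : ℕ → ℝ} (ht : t ∈ Set.Ico (0 : ℝ) 1)
    (ha : ∀ i, a i ∈ Set.Ioo (0 : ℝ) 1) (n : ℕ) (s : Fin n → Bool) :
    sampleMeasure (stringEvent t a n (extendString s)) = ENNReal.ofReal (stringProb t a n s) := by
  have := (stringEvent_box ht ha n s).2 ∅ (fun _ => ∅) (by simp) (by simp)
  simpa using this

theorem sum_stringProb {t : ℝ} {a : ℕ → ℝ} (ht : t ∈ Set.Ico (0 : ℝ) 1)
    (ha : ∀ i, a i ∈ Set.Ioo (0 : ℝ) 1) (n : ℕ) :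
    ∑ s : Fin n → Bool, ENNReal.ofReal (stringProb t a n s) = 1 := by
  simp only [← sampleMeasure_stringEvent ht ha]
  rw [← tsum_fintype (L := SummationFilter.unconditional _), ← measure_iUnion]
  · have : ⋃ s : Fin n → Bool, stringEvent t a n (extendString s) = Set.univ := by
      refine Set.eq_univ_of_forall fun ω => Set.mem_iUnion.2
        ⟨fun i => pathsAbove t a ω n i, fun k hk => ?_⟩
      simp [extendString, hk]
    rw [this, sampleMeasure, measure_univ]
  · intro r r' hne
    refine Set.disjoint_left.2 fun ω h h' => hne ?_
    ext i
    rw [← extendString_coe r, ← extendString_coe r', ← h i i.isLt, ← h' i i.isLt]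
  · exact fun s => (stringEvent_box ht ha n s).1

/-! ### Sequences of partitions, column by column -/

/-- The weight of a sequence of partitions that starts at `mu`, without the normalization. -/
noncomputable def chainWeight (t : ℝ) :
    (n : ℕ) → (a : ℕ → ℝ) → (mu : YoungDiagram) → (L : Fin n → YoungDiagram) → ℝ
  | 0, _, mu, _ => evenWeight t mu
  | n + 1, a, mu, L =>
      skewComb t (a 0) (L 0) mu * chainWeight t n (fun i => a (i + 1)) (L 0) (Fin.tail L)

/-- The lengths in the sequence of partitions `mu, L 0, L 1, …` have the increments `s`. -/
def HasSupport :
    (n : ℕ) → (mu : YoungDiagram) → (L : Fin n → YoungDiagram) → (s : Fin n → Bool) → Prop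
  | 0, _, _, _ => True
  | n + 1, mu, L, s =>
      len (L 0) = len mu + (s 0).toNat ∧ HasSupport n (L 0) (Fin.tail L) (Fin.tail s)

/-- The partial sums of a string, starting from `c`. -/
def partialSums : (n : ℕ) → (c : ℕ) → (s : Fin n → Bool) → Fin n → ℕ
  | 0, _, _ => Fin.elim0
  | n + 1, c, s => Fin.cons (c + (s 0).toNat) (partialSums n (c + (s 0).toNat) (Fin.tail s))

theorem hasSupport_iff_len {n : ℕ} {mu : YoungDiagram} {L : Fin n → YoungDiagram}
    {s : Fin n → Bool} :
    HasSupport n mu L s ↔ ∀ k, len (L k) = partialSums n (len mu) s k := by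
  induction n generalizing mu with
  | zero => exact ⟨fun _ k => k.elim0, fun _ => trivial⟩
  | succ n ih =>
    rw [HasSupport, ih, Fin.forall_fin_succ]
    simp only [partialSums, Fin.cons_zero, Fin.cons_succ, Fin.tail]
    exact and_congr_right fun h => by rw [h]

theorem partialSums_injective (n c : ℕ) : Function.Injective (partialSums n c) := by
  induction n generalizing c with
  | zero => exact fun s s' _ => Subsingleton.elim s s'
  | succ n ih =>
    intro s s' h
    simp only [partialSums] at h
    rw [Fin.cons_inj] at h
    obtain ⟨h0, h1⟩ := h
    have e : s 0 = s' 0 := by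
      revert h0
      cases s 0 <;> cases s' 0 <;> simp
    rw [e] at h1
    rw [← Fin.cons_self_tail s, ← Fin.cons_self_tail s', e, ih _ h1]

theorem HasSupport.unique {n : ℕ} {mu : YoungDiagram} {L : Fin n → YoungDiagram}
    {s s' : Fin n → Bool} (h : HasSupport n mu L s) (h' : HasSupport n mu L s') : s = s' := by
  refine partialSums_injective n (len mu) (funext fun k => ?_)
  rw [← hasSupport_iff_len.1 h, hasSupport_iff_len.1 h']

theorem exists_hasSupport {t : ℝ} {n : ℕ} {a : ℕ → ℝ} {mu : YoungDiagram}
    {L : Fin n → YoungDiagram} (h : chainWeight t n a mu L ≠ 0) : ∃ s, HasSupport n mu L s := by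
  induction n generalizing a mu with
  | zero => exact ⟨Fin.elim0, trivial⟩
  | succ n ih =>
    rw [chainWeight] at h
    obtain ⟨s, hs⟩ := ih (right_ne_zero_of_mul h)
    rcases len_of_skewComb_ne_zero (left_ne_zero_of_mul h) with h0 | h0
    · exact ⟨Fin.cons false s, by simpa using h0.symm, by simpa using hs⟩
    · exact ⟨Fin.cons true s, by simpa using h0.symm, by simpa using hs⟩

theorem exists_hasSupport_dropCol {t : ℝ} {n : ℕ} {a : ℕ → ℝ} {mu : YoungDiagram}
    {L : Fin n → YoungDiagram} (h : chainWeight t n a mu L ≠ 0) :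
    ∃ s, HasSupport n (dropCol mu) (fun k => dropCol (L k)) s := by
  induction n generalizing a mu with
  | zero => exact ⟨Fin.elim0, trivial⟩
  | succ n ih =>
    rw [chainWeight] at h
    obtain ⟨s, hs⟩ := ih (right_ne_zero_of_mul h)
    have h1 := left_ne_zero_of_mul h
    rw [skewComb_apply] at h1
    rcases len_of_skewComb_ne_zero (right_ne_zero_of_mul h1) with h0 | h0
    · exact ⟨Fin.cons false s, by simpa using h0.symm, by rwa [Fin.tail_cons]⟩
    · exact ⟨Fin.cons true s, by simpa using h0.symm, by rwa [Fin.tail_cons]⟩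

theorem stepWeight_nonneg {t z : ℝ} (ht : t ∈ Set.Ico (0 : ℝ) 1) (hz : 0 < z) (m : ℕ)
    (s s' : Bool) : 0 ≤ stepWeight t z m s s' := by
  have := pow_le_one₀ ht.1 ht.2.le (n := m)
  rw [stepWeight]
  refine mul_nonneg ?_ ?_ <;> split_ifs <;> linarith

theorem transfer_nonneg {t : ℝ} {f : ℕ → ℝ} (ht : t ∈ Set.Ico (0 : ℝ) 1) (hf : ∀ m, 0 ≤ f m)
    {n : ℕ} {a : ℕ → ℝ} (ha : ∀ i, 0 < a i) (m : ℕ) (s s' : Fin n → Bool) :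
    0 ≤ transfer t f n a m s s' := by
  induction n generalizing a m with
  | zero => exact hf m
  | succ n ih =>
    exact mul_nonneg (stepWeight_nonneg ht (ha 0) _ _ _) (ih (fun i => ha (i + 1)) _ _ _)

theorem chainWeight_nonneg {t : ℝ} (ht : t ∈ Set.Ico (0 : ℝ) 1) {n : ℕ} {a : ℕ → ℝ}
    (ha : ∀ i, 0 < a i) (mu : YoungDiagram) (L : Fin n → YoungDiagram) :
    0 ≤ chainWeight t n a mu L := by
  induction n generalizing a mu with
  | zero => exact evenWeight_nonneg ht mu
  | succ n ih => exact mul_nonneg (skewComb_nonneg ht (ha 0) _ _) (ih (fun i => ha (i + 1)) _ _)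

/-- Removing the first column from all partitions of a sequence. -/
theorem chainWeight_eq_transfer {t : ℝ} {n : ℕ} {a : ℕ → ℝ} {mu : YoungDiagram}
    {L : Fin n → YoungDiagram} {s s' : Fin n → Bool} (h : HasSupport n mu L s)
    (h' : HasSupport n (dropCol mu) (fun k => dropCol (L k)) s') :
    chainWeight t n a mu L =
      transfer t (endWeight t) n a (len mu - len (dropCol mu)) s s' *
        chainWeight t n a (dropCol mu) fun k => dropCol (L k) := by
  induction n generalizing a mu with
  | zero => exact evenWeight_eq t mu
  | succ n ih =>
    obtain ⟨h0, h1⟩ := h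
    obtain ⟨h0', h1'⟩ := h'
    dsimp only at h0' h1'
    have e : (Fin.tail fun k => dropCol (L k)) = fun k => dropCol (Fin.tail L k) := rfl
    rw [e] at h1'
    have hle := len_dropCol_le mu
    have hle' := len_dropCol_le (L 0)
    have hm : len (L 0) - len (dropCol (L 0)) =
        len mu - len (dropCol mu) + (s 0).toNat - (s' 0).toNat := by omega
    have hstep : skewComb t (a 0) (L 0) mu =
        stepWeight t (a 0) (len mu - len (dropCol mu)) (s 0) (s' 0) *
          skewComb t (a 0) (dropCol (L 0)) (dropCol mu) := by
      rw [skewComb_apply, stepWeight, h0, stayWeight, h0']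
      cases s 0 <;> cases s' 0 <;> simp
    rw [chainWeight, ih h1 h1', transfer, chainWeight, hstep, hm, e]
    ring

/-- The transfer matrix is triangular for the dominance order. -/
theorem partialSums_le_of_transfer_ne_zero {t : ℝ} {f : ℕ → ℝ} {n : ℕ} {a : ℕ → ℝ} {c c' m : ℕ}
    {s s' : Fin n → Bool} (h : transfer t f n a m s s' ≠ 0) (hc : c' + m = c) :
    partialSums n c' s' ≤ partialSums n c s := by
  induction n generalizing a c c' m with
  | zero => exact fun k => k.elim0
  | succ n ih =>
    rw [transfer] at h
    -- A step down from `m = 0` has weight `1 - t ^ 0 = 0`.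
    have hm : (s' 0).toNat ≤ m + (s 0).toNat := by
      by_contra hlt
      refine left_ne_zero_of_mul h ?_
      have h0 : m = 0 := by
        have := Bool.toNat_le (s' 0)
        omega
      have h1 : s 0 = false := by
        have := Bool.toNat_le (s' 0)
        rw [← Bool.toNat_eq_zero]
        omega
      have h2 : s' 0 = true := by
        rw [← Bool.toNat_eq_one]
        have := Bool.toNat_le (s' 0)
        omega
      simp [stepWeight, h0, h1, h2]
    have := ih (c := c + (s 0).toNat) (c' := c' + (s' 0).toNat) (right_ne_zero_of_mul h) (by omega)
    simp only [partialSums]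
    refine Fin.cons_le_cons.2 ⟨by omega, this⟩

theorem transfer_self (t : ℝ) (f : ℕ → ℝ) (n : ℕ) (a : ℕ → ℝ) (m : ℕ) (s : Fin n → Bool) :
    transfer t f n a m s s = (∏ i, if s i then a i else 1) * f m := by
  induction n generalizing a with
  | zero => simp [transfer]
  | succ n ih =>
    have e : ∀ i : Fin n, (if s i.succ then a i.succ else 1) =
        if Fin.tail s i then a (i + 1) else 1 := fun _ => rfl
    rw [transfer, Nat.add_sub_cancel, ih, Fin.prod_univ_succ, stepWeight]
    simp only [e]
    cases s 0 <;> simp [mul_assoc]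

/-- The transfer matrix has, up to normalization, only one fixed vector. -/
theorem eq_zero_of_transfer_fixed {t : ℝ} {n : ℕ} {a : ℕ → ℝ} (ha : ∀ i, a i ∈ Set.Ioo (0 : ℝ) 1)
    {d : (Fin n → Bool) → ℝ} (h0 : d (fun _ => false) = 0)
    (hd : ∀ s, d s = ∑ s', transfer t (endWeight t) n a 0 s s' * d s') (s : Fin n → Bool) :
    d s = 0 := by
  induction hN : ∑ k, partialSums n 0 s k using Nat.strong_induction_on generalizing s with
  | _ N ih =>
    by_cases hs : s = fun _ => false
    · rw [hs, h0]
    obtain ⟨i, hi⟩ : ∃ i, s i = true := by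
      by_contra hcon
      refine hs (funext fun i => ?_)
      simpa using fun hi => hcon ⟨i, hi⟩
    have hlt : transfer t (endWeight t) n a 0 s s < 1 := by
      rw [transfer_self, endWeight_zero, mul_one, ← Finset.mul_prod_erase _ _ (Finset.mem_univ i),
        if_pos hi]
      refine mul_lt_one_of_nonneg_of_lt_one_left (ha i).1.le (ha i).2 (Finset.prod_le_one ?_ ?_)
      · intro k _
        split_ifs
        exacts [(ha k).1.le, zero_le_one]
      · intro k _
        split_ifs
        exacts [(ha k).2.le, le_rfl]
    have h1 := hd s
    rw [Finset.sum_eq_single s] at h1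
    · have : (1 - transfer t (endWeight t) n a 0 s s) * d s = 0 := by linarith
      exact (mul_eq_zero.1 this).resolve_left (by linarith)
    · intro s' _ hne
      by_cases hT : transfer t (endWeight t) n a 0 s s' = 0
      · rw [hT, zero_mul]
      have hle := partialSums_le_of_transfer_ne_zero hT (Nat.add_zero 0)
      have hlt' : partialSums n 0 s' < partialSums n 0 s :=
        lt_of_le_of_ne hle fun h => hne (partialSums_injective n 0 h)
      obtain ⟨hle', k, hk⟩ := Pi.lt_def.1 hlt'
      rw [ih _ (hN ▸ Finset.sum_lt_sum (fun k _ => hle' k) ⟨k, Finset.mem_univ k, hk⟩) s' rfl,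
        mul_zero]
    · exact fun h => absurd (Finset.mem_univ s) h

/-! ### The law of the lengths in the half-space process -/

open Classical in
/-- The total weight, with an additional factor `phi`, of all sequences of partitions whose lengths
have the increments `s`. -/
noncomputable def supportSum (t : ℝ) (a : ℕ → ℝ) (n : ℕ) (phi : (Fin n → YoungDiagram) → ENNReal)
    (s : Fin n → Bool) : ENNReal :=
  ∑' L : Fin n → YoungDiagram,
    if HasSupport n ⊥ L s then ENNReal.ofReal (chainWeight t n a ⊥ L) * phi L else 0

/-- The sum over all sequences with given increments reduces, by removing the first columns, to the
sums over the sequences with the increments of the second columns. -/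
theorem supportSum_eq_sum_transfer {t : ℝ} (ht : t ∈ Set.Ico (0 : ℝ) 1) {a : ℕ → ℝ}
    (ha : ∀ i, 0 < a i) (n : ℕ) (phi : (Fin n → YoungDiagram) → ENNReal) (s : Fin n → Bool) :
    supportSum t a n (fun L => phi fun k => dropCol (L k)) s =
      ∑ s', ENNReal.ofReal (transfer t (endWeight t) n a 0 s s') * supportSum t a n phi s' := by
  classical
  simp only [supportSum, ← ENNReal.tsum_mul_left]
  rw [← Summable.tsum_finsetSum fun _ _ => ENNReal.summable]
  set g : (Fin n → YoungDiagram) → ENNReal := fun L' => ∑ s',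
    ENNReal.ofReal (transfer t (endWeight t) n a 0 s s') *
      if HasSupport n ⊥ L' s' then ENNReal.ofReal (chainWeight t n a ⊥ L') * phi L' else 0 with hg
  have hgeq : ∀ L' s', HasSupport n ⊥ L' s' → g L' =
      ENNReal.ofReal (transfer t (endWeight t) n a 0 s s' * chainWeight t n a ⊥ L') * phi L' := by
    intro L' s' h
    rw [hg]
    dsimp only
    rw [Finset.sum_eq_single s', if_pos h, ENNReal.ofReal_mul, mul_assoc]
    · exact transfer_nonneg ht (endWeight_nonneg ht) ha _ _ _
    · intro s'' _ hne
      rw [if_neg fun h' => hne (h'.unique h), mul_zero]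
    · exact fun h => absurd (Finset.mem_univ _) h
  have hfeq : ∀ L, HasSupport n ⊥ L s → chainWeight t n a ⊥ L ≠ 0 →
      ENNReal.ofReal (chainWeight t n a ⊥ L) * phi (fun k => dropCol (L k)) =
        g fun k => dropCol (L k) := by
    intro L h hne
    obtain ⟨s', hs'⟩ := exists_hasSupport_dropCol hne
    rw [chainWeight_eq_transfer h hs']
    rw [dropCol_bot] at hs' ⊢
    rw [hgeq _ _ hs', Nat.sub_self]
  -- Sequences without their first columns correspond to sequences with increments `s`.
  have hcol : ∀ L', g L' ≠ 0 →
      HasSupport n ⊥ (fun k => addCol (partialSums n 0 s k) (L' k)) s := by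
    intro L' h
    obtain ⟨s', -, hs'⟩ := Finset.exists_ne_zero_of_sum_ne_zero h
    have hT : transfer t (endWeight t) n a 0 s s' ≠ 0 := fun h0 =>
      left_ne_zero_of_mul hs' (by rw [h0, ENNReal.ofReal_zero])
    have hL' : HasSupport n ⊥ L' s' := by
      by_contra hcon
      exact right_ne_zero_of_mul hs' (if_neg hcon)
    rw [hasSupport_iff_len] at hL' ⊢
    intro k
    rw [len_addCol, len_bot]
    rw [hL', len_bot]
    exact partialSums_le_of_transfer_ne_zero hT (Nat.add_zero 0) k
  have hval : ∀ L', g L' ≠ 0 → ENNReal.ofReal (chainWeight t n a ⊥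
      fun k => addCol (partialSums n 0 s k) (L' k)) * phi L' = g L' := by
    intro L' h
    obtain ⟨s', -, hs'⟩ := Finset.exists_ne_zero_of_sum_ne_zero h
    have hL' : HasSupport n ⊥ L' s' := by
      by_contra hcon
      exact right_ne_zero_of_mul hs' (if_neg hcon)
    rw [hgeq _ _ hL']
    have := chainWeight_eq_transfer (t := t) (a := a) (hcol L' h) (s' := s')
      (by simpa only [dropCol_addCol, dropCol_bot] using hL')
    rw [this]
    simp only [dropCol_addCol, dropCol_bot, Nat.sub_self]
  refine tsum_eq_tsum_of_ne_zero_bij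
    (fun L' : Function.support g => fun k => addCol (partialSums n 0 s k) (L'.1 k)) ?_ ?_ ?_
  · intro L' L'' h
    refine Subtype.ext (funext fun k => ?_)
    have hk := congrArg dropCol (congrFun h k)
    simpa only [dropCol_addCol] using hk
  · intro L hL
    rw [Function.mem_support] at hL
    have hs : HasSupport n ⊥ L s := by
      by_contra hcon
      exact hL (if_neg hcon)
    rw [if_pos hs] at hL
    have hne : chainWeight t n a ⊥ L ≠ 0 := fun h0 =>
      left_ne_zero_of_mul hL (by rw [h0, ENNReal.ofReal_zero])
    rw [hfeq L hs hne] at hL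
    refine ⟨⟨_, hL⟩, funext fun k => ?_⟩
    have hk := hasSupport_iff_len.1 hs k
    rw [len_bot] at hk
    change addCol (partialSums n 0 s k) (dropCol (L k)) = L k
    rw [← hk, addCol_dropCol]
  · rintro ⟨L', h⟩
    rw [if_pos (hcol L' h)]
    simp only [dropCol_addCol]
    exact hval L' h

theorem chainWeight_bot (t : ℝ) (n : ℕ) (a : ℕ → ℝ) : chainWeight t n a ⊥ (fun _ => ⊥) = 1 := by
  induction n generalizing a with
  | zero => exact evenWeight_bot t
  | succ n ih =>
    have e : (Fin.tail fun _ : Fin (n + 1) => (⊥ : YoungDiagram)) = fun _ => ⊥ := rfl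
    rw [chainWeight, e, ih, skewComb_bot, Finsupp.single_eq_same, mul_one]

theorem hasSupport_bot (n : ℕ) : HasSupport n ⊥ (fun _ => ⊥) (fun _ => false) := by
  induction n with
  | zero => trivial
  | succ n ih => exact ⟨by simp, ih⟩

open Classical in
/-- The indicator of the sequences of partitions with at most `K` columns. -/
noncomputable def columnsLE (n K : ℕ) (L : Fin n → YoungDiagram) : ENNReal :=
  if ∀ k, (L k).rowLen 0 ≤ K then 1 else 0

theorem columnsLE_succ (n K : ℕ) (L : Fin n → YoungDiagram) :
    columnsLE n (K + 1) L = columnsLE n K fun k => dropCol (L k) := by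
  simp only [columnsLE, rowLen_dropCol, Nat.sub_le_iff_le_add]

theorem supportSum_columnsLE_zero {t : ℝ} {n : ℕ} {a : ℕ → ℝ} (s : Fin n → Bool) :
    supportSum t a n (columnsLE n 0) s = if s = fun _ => false then 1 else 0 := by
  classical
  have hL : ∀ L : Fin n → YoungDiagram, L ≠ (fun _ => ⊥) → columnsLE n 0 L = 0 := by
    intro L hL
    refine if_neg fun h => hL (funext fun k => ?_)
    rw [← len_eq_zero, ← Nat.le_zero]
    exact rowLen_eq_zero.1 (Nat.le_zero.1 (h k))
  rw [supportSum, tsum_eq_single fun _ => ⊥]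
  · have h1 : columnsLE n 0 (fun _ => ⊥) = 1 := if_pos fun _ => (rowLen_eq_zero.2 len_bot.le).le
    rw [chainWeight_bot, h1]
    split_ifs with h2 h3 h3
    · simp
    · exact absurd (h2.unique (hasSupport_bot n)) h3
    · exact absurd (h3 ▸ hasSupport_bot n) h2
    · rfl
  · intro L h
    rw [hL L h, mul_zero, ite_self]

/-- The law of the path string, normalized to `1` at the empty string. -/
noncomputable def scaledProb (t : ℝ) (a : ℕ → ℝ) (n : ℕ) (s : Fin n → Bool) : ℝ :=
  Phi t a n * stringProb t a n s

theorem Phi_pos {t : ℝ} {a : ℕ → ℝ} (ht : t ∈ Set.Ico (0 : ℝ) 1)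
    (ha : ∀ i, a i ∈ Set.Ioo (0 : ℝ) 1) (n : ℕ) : 0 < Phi t a n := by
  refine Finset.prod_pos fun i _ => Finset.prod_pos fun j _ => ?_
  have hu := mul_mem_Ioo ha i j
  refine div_pos ?_ (sub_pos.2 hu.2)
  nlinarith [ht.1, ht.2, hu.1, hu.2]

theorem scaledProb_nonneg {t : ℝ} {a : ℕ → ℝ} (ht : t ∈ Set.Ico (0 : ℝ) 1)
    (ha : ∀ i, a i ∈ Set.Ioo (0 : ℝ) 1) (n : ℕ) (s : Fin n → Bool) : 0 ≤ scaledProb t a n s :=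
  mul_nonneg (Phi_pos ht ha n).le (stringProb_nonneg ht ha n s)

theorem scaledProb_eq_sum {t : ℝ} {a : ℕ → ℝ} (ht : t ∈ Set.Ico (0 : ℝ) 1)
    (ha : ∀ i, a i ∈ Set.Ioo (0 : ℝ) 1) (n : ℕ) (s : Fin n → Bool) :
    scaledProb t a n s = ∑ s', transfer t (endWeight t) n a 0 s s' * scaledProb t a n s' := by
  have hu : ∀ i j, 1 - t * (a i * a j) ≠ 0 := fun i j => by
    have hu := mul_mem_Ioo ha i j
    have : 0 < 1 - t * (a i * a j) := by nlinarith [ht.1, ht.2, hu.1, hu.2]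
    exact this.ne'
  rw [scaledProb, stringProb_eq_sum_transfer hu n s, Finset.mul_sum]
  refine Finset.sum_congr rfl fun s' _ => ?_
  rw [scaledProb]
  ring

theorem scaledProb_empty {t : ℝ} {a : ℕ → ℝ} (ht : t ∈ Set.Ico (0 : ℝ) 1)
    (ha : ∀ i, a i ∈ Set.Ioo (0 : ℝ) 1) (n : ℕ) : scaledProb t a n (fun _ => false) = 1 := by
  rw [scaledProb, stringProb_empty, mul_inv_cancel₀ (Phi_pos ht ha n).ne']

theorem supportSum_columnsLE_le {t : ℝ} {a : ℕ → ℝ} (ht : t ∈ Set.Ico (0 : ℝ) 1)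
    (ha : ∀ i, a i ∈ Set.Ioo (0 : ℝ) 1) (n K : ℕ) (s : Fin n → Bool) :
    supportSum t a n (columnsLE n K) s ≤ ENNReal.ofReal (scaledProb t a n s) := by
  induction K generalizing s with
  | zero =>
    rw [supportSum_columnsLE_zero]
    split_ifs with h
    · rw [h, scaledProb_empty ht ha, ENNReal.ofReal_one]
    · exact zero_le
  | succ K ih =>
    have e : columnsLE n (K + 1) = fun L => columnsLE n K fun k => dropCol (L k) :=
      funext (columnsLE_succ n K)
    have hT := fun s' => transfer_nonneg ht (endWeight_nonneg ht) (fun i => (ha i).1) 0 s s'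
    rw [e, supportSum_eq_sum_transfer ht fun i => (ha i).1, scaledProb_eq_sum ht ha,
      ENNReal.ofReal_sum_of_nonneg fun s' _ => mul_nonneg (hT s') (scaledProb_nonneg ht ha n s')]
    refine Finset.sum_le_sum fun s' _ => ?_
    rw [ENNReal.ofReal_mul (hT s')]
    gcongr
    exact ih s'

theorem supportSum_le {t : ℝ} {a : ℕ → ℝ} (ht : t ∈ Set.Ico (0 : ℝ) 1)
    (ha : ∀ i, a i ∈ Set.Ioo (0 : ℝ) 1) (n : ℕ) (s : Fin n → Bool) :
    supportSum t a n (fun _ => 1) s ≤ ENNReal.ofReal (scaledProb t a n s) := by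
  classical
  rw [supportSum, ENNReal.tsum_eq_iSup_sum]
  refine iSup_le fun F => le_trans ?_ (supportSum_columnsLE_le ht ha n
    (F.sup fun L => Finset.univ.sup fun k => (L k).rowLen 0) s)
  refine le_trans (Finset.sum_le_sum fun L hL => ?_) (ENNReal.sum_le_tsum F)
  have : columnsLE n (F.sup fun L => Finset.univ.sup fun k => (L k).rowLen 0) L = 1 := by
    refine if_pos fun k => le_trans ?_ (Finset.le_sup hL)
    exact Finset.le_sup (f := fun k => (L k).rowLen 0) (Finset.mem_univ k)
  rw [this]

/-- The total weight of the sequences of partitions with given increments of the lengths. -/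
theorem supportSum_one {t : ℝ} {a : ℕ → ℝ} (ht : t ∈ Set.Ico (0 : ℝ) 1)
    (ha : ∀ i, a i ∈ Set.Ioo (0 : ℝ) 1) (n : ℕ) (s : Fin n → Bool) :
    supportSum t a n (fun _ => 1) s = ENNReal.ofReal (scaledProb t a n s) := by
  have hfin : ∀ s, supportSum t a n (fun _ => 1) s ≠ ⊤ := fun s =>
    ne_top_of_le_ne_top ENNReal.ofReal_ne_top (supportSum_le ht ha n s)
  have hle0 : 1 ≤ supportSum t a n (fun _ => 1) (fun _ => false) := by
    have h := supportSum_columnsLE_zero (t := t) (a := a) (n := n) fun _ => false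
    rw [if_pos rfl] at h
    refine h.ge.trans ?_
    rw [supportSum, supportSum]
    refine ENNReal.tsum_le_tsum fun L => ?_
    have : columnsLE n 0 L ≤ 1 := by
      rw [columnsLE]
      split_ifs
      exacts [le_rfl, zero_le]
    split_ifs
    · gcongr
    · exact le_rfl
  -- Both sides are fixed vectors of the transfer matrix with the value `1` at the empty string.
  have hzero := eq_zero_of_transfer_fixed (t := t) ha (d := fun s =>
    scaledProb t a n s - (supportSum t a n (fun _ => 1) s).toReal) ?_ (fun s => ?_) s
  · rw [sub_eq_zero] at hzero
    rw [hzero, ENNReal.ofReal_toReal (hfin s)]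
  · have := supportSum_le ht ha n fun _ => false
    rw [scaledProb_empty ht ha, ENNReal.ofReal_one] at this
    rw [scaledProb_empty ht ha, le_antisymm this hle0, ENNReal.toReal_one, sub_self]
  · have h := supportSum_eq_sum_transfer ht (fun i => (ha i).1) n (fun _ => 1) s
    have hT := fun s' => transfer_nonneg ht (endWeight_nonneg ht) (fun i => (ha i).1) 0 s s'
    rw [h, scaledProb_eq_sum ht ha, ENNReal.toReal_sum fun s' _ =>
      ENNReal.mul_ne_top ENNReal.ofReal_ne_top (hfin s'), ← Finset.sum_sub_distrib]
    refine Finset.sum_congr rfl fun s' _ => ?_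
    rw [ENNReal.toReal_mul, ENNReal.toReal_ofReal (hT s')]
    ring

/-! ### Comparison of the two laws -/

theorem weightHL_eq {t : ℝ} {a : ℕ → ℝ} (ht : t ∈ Set.Ico (0 : ℝ) 1) (ha : ∀ i, 0 < a i) {n : ℕ}
    (L : Fin n → YoungDiagram) : weightHL t a L = chainWeight t n a ⊥ L / Phi t a n := by
  have h : ∀ (n : ℕ) (a : ℕ → ℝ) (mu : YoungDiagram) (L : Fin n → YoungDiagram),
      chainWeight t n a mu L =
        (∏ i : Fin n, skewComb t (a i) ((Fin.cons mu L : Fin (n + 1) → YoungDiagram) i.succ)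
          ((Fin.cons mu L : Fin (n + 1) → YoungDiagram) i.castSucc)) *
        evenWeight t ((Fin.cons mu L : Fin (n + 1) → YoungDiagram) (Fin.last n)) := by
    intro n
    induction n with
    | zero => intro a mu L; simp [chainWeight]
    | succ n ih =>
      intro a mu L
      have e : ∀ j, L j = (Fin.cons (L 0) (Fin.tail L) : Fin (n + 1) → YoungDiagram) j :=
        fun j => by rw [Fin.cons_self_tail]
      rw [chainWeight, ih, Fin.prod_univ_succ, ← Fin.succ_last, Fin.cons_succ, ← e, mul_assoc]
      simp only [Fin.cons_succ, Fin.castSucc_zero, Fin.cons_zero, ← Fin.succ_castSucc, ← e,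
        Fin.val_succ, Fin.val_zero]
  have h' : chainWeight t n a ⊥ L =
      (∏ i : Fin n, skewComb t (a i) (extend L i.succ) (extend L i.castSucc)) *
        evenWeight t (extend L (Fin.last n)) := h n a ⊥ L
  rw [h', weightHL, evenWeight]
  simp only [skewP_eq ht (ha _)]
  ring

/-- The integer vector of a string. -/
def toIntString {n : ℕ} (s : Fin n → Bool) (i : Fin n) : ℤ := if s i then 1 else 0

theorem toIntString_injective (n : ℕ) : Function.Injective (toIntString (n := n)) := by
  intro s s' h
  ext i
  have := congrFun h i
  simp only [toIntString] at this
  revert this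
  cases s i <;> cases s' i <;> simp

theorem support_eq_iff {n : ℕ} (L : Fin n → YoungDiagram) (s : Fin n → Bool) :
    support L = toIntString s ↔ HasSupport n ⊥ L s := by
  have h : ∀ (n : ℕ) (mu : YoungDiagram) (L : Fin n → YoungDiagram) (s : Fin n → Bool),
      HasSupport n mu L s ↔ ∀ i : Fin n,
        (len ((Fin.cons mu L : Fin (n + 1) → YoungDiagram) i.succ) : ℤ) -
          len ((Fin.cons mu L : Fin (n + 1) → YoungDiagram) i.castSucc) = toIntString s i := by
    intro n
    induction n with
    | zero => exact fun _ _ _ => ⟨fun _ i => i.elim0, fun _ => trivial⟩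
    | succ n ih =>
      intro mu L s
      have e : ∀ j, L j = (Fin.cons (L 0) (Fin.tail L) : Fin (n + 1) → YoungDiagram) j :=
        fun j => by rw [Fin.cons_self_tail]
      rw [HasSupport, ih, Fin.forall_fin_succ]
      simp only [Fin.cons_succ, Fin.castSucc_zero, Fin.cons_zero, ← Fin.succ_castSucc, ← e]
      refine and_congr ?_ Iff.rfl
      rw [toIntString]
      cases s 0 <;> simp <;> omega
  rw [h, funext_iff]
  rfl

instance : Countable YoungDiagram :=
  Function.Injective.countable (f := YoungDiagram.cells) fun _ _ h => YoungDiagram.ext h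

theorem PHL_apply (t : ℝ) (a : ℕ → ℝ) (n : ℕ) (S : Set (Fin n → YoungDiagram)) :
    PHL t a n S = ∑' L, S.indicator (fun L => ENNReal.ofReal (weightHL t a L)) L := by
  rw [PHL, Measure.sum_apply_of_countable]
  refine tsum_congr fun L => ?_
  rw [Measure.smul_apply, Measure.dirac_apply, smul_eq_mul]
  by_cases h : L ∈ S <;> simp [h]

theorem PHL_support {t : ℝ} {a : ℕ → ℝ} (ht : t ∈ Set.Ico (0 : ℝ) 1)
    (ha : ∀ i, a i ∈ Set.Ioo (0 : ℝ) 1) {n : ℕ} (s : Fin n → Bool) :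
    PHL t a n {L | support L = toIntString s} = ENNReal.ofReal (stringProb t a n s) := by
  classical
  have hPhi := Phi_pos ht ha n
  have h1 : PHL t a n {L | support L = toIntString s} =
      ENNReal.ofReal (Phi t a n)⁻¹ * supportSum t a n (fun _ => 1) s := by
    rw [PHL_apply, supportSum, ← ENNReal.tsum_mul_left]
    refine tsum_congr fun L => ?_
    rw [Set.indicator_apply, weightHL_eq ht fun i => (ha i).1,
      div_eq_inv_mul, ENNReal.ofReal_mul (inv_nonneg.2 hPhi.le), mul_one, mul_ite, mul_zero]
    exact if_congr (support_eq_iff L s) rfl rfl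
  rw [h1, supportSum_one ht ha, ← ENNReal.ofReal_mul (inv_nonneg.2 hPhi.le), scaledProb,
    inv_mul_cancel_left₀ hPhi.ne']

theorem PHL_support_of_notMem_range {t : ℝ} {a : ℕ → ℝ} (ht : t ∈ Set.Ico (0 : ℝ) 1)
    (ha : ∀ i, a i ∈ Set.Ioo (0 : ℝ) 1) {n : ℕ} :
    PHL t a n {L | support L ∉ Set.range toIntString} = 0 := by
  rw [PHL_apply, ENNReal.tsum_eq_zero]
  intro L
  rw [Set.indicator_apply_eq_zero]
  intro hL
  rw [weightHL_eq ht fun i => (ha i).1]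
  by_cases h0 : chainWeight t n a ⊥ L = 0
  · rw [h0, zero_div, ENNReal.ofReal_zero]
  · obtain ⟨s, hs⟩ := exists_hasSupport h0
    exact absurd ⟨s, ((support_eq_iff L s).2 hs).symm⟩ hL

theorem PHL_univ {t : ℝ} {a : ℕ → ℝ} (ht : t ∈ Set.Ico (0 : ℝ) 1)
    (ha : ∀ i, a i ∈ Set.Ioo (0 : ℝ) 1) (n : ℕ) : PHL t a n Set.univ = 1 := by
  have hu : (Set.univ : Set (Fin n → YoungDiagram)) =
      (⋃ s : Fin n → Bool, {L | support L = toIntString s}) ∪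
        {L | support L ∉ Set.range toIntString} := by
    ext L
    by_cases h : support L ∈ Set.range toIntString
    · obtain ⟨s, hs⟩ := h
      simp only [Set.mem_univ, true_iff]
      exact Or.inl (Set.mem_iUnion.2 ⟨s, hs.symm⟩)
    · simp only [Set.mem_univ, true_iff]
      exact Or.inr h
  have hm : ∀ S : Set (Fin n → YoungDiagram), MeasurableSet S := fun S =>
    S.to_countable.measurableSet
  have hd : Disjoint (⋃ s : Fin n → Bool, {L : Fin n → YoungDiagram | support L = toIntString s})
      {L | support L ∉ Set.range toIntString} := by
    refine Set.disjoint_left.2 fun L h h' => h' ?_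
    obtain ⟨s, hs⟩ := Set.mem_iUnion.1 h
    exact ⟨s, Eq.symm hs⟩
  rw [hu, measure_union hd (hm _), PHL_support_of_notMem_range ht ha, add_zero, measure_iUnion,
    tsum_fintype]
  · simp only [PHL_support ht ha]
    exact sum_stringProb ht ha n
  · intro s s' hne
    refine Set.disjoint_left.2 fun L h h' => hne (toIntString_injective n ?_)
    exact Eq.trans (Eq.symm h) h'
  · exact fun s => hm _

theorem pathString_eq_iff {t : ℝ} {a : ℕ → ℝ} {n : ℕ} (s : Fin n → Bool) (ω : Sample) :
    pathString t a n ω = toIntString s ↔ ω ∈ stringEvent t a n (extendString s) := by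
  rw [stringEvent, Set.mem_ofPred_eq]
  have h : pathString t a n ω = toIntString fun k : Fin n => pathsAbove t a ω n k := rfl
  rw [h, (toIntString_injective n).eq_iff, funext_iff]
  refine ⟨fun h k hk => ?_, fun h k => ?_⟩
  · rw [extendString, dif_pos hk]
    exact h ⟨k, hk⟩
  · rw [h k k.isLt, extendString_coe]

theorem PHL_support_eq_pathString {t : ℝ} {a : ℕ → ℝ} (ht : t ∈ Set.Ico (0 : ℝ) 1)
    (ha : ∀ i, a i ∈ Set.Ioo (0 : ℝ) 1) {n : ℕ} (s : Fin n → ℤ) :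
    PHL t a n {L | support L = s} = sampleMeasure {ω | pathString t a n ω = s} := by
  by_cases h : s ∈ Set.range toIntString
  · obtain ⟨s, rfl⟩ := h
    simp only [pathString_eq_iff]
    rw [PHL_support ht ha]
    exact (sampleMeasure_stringEvent ht ha n s).symm
  · have h1 : {ω | pathString t a n ω = s} = ∅ := by
      refine Set.eq_empty_of_forall_notMem fun ω hω => h ?_
      exact ⟨fun k => pathsAbove t a ω n k, hω⟩
    rw [h1, measure_empty]
    refine measure_mono_null (fun L hL => ?_) (PHL_support_of_notMem_range ht ha)
    rw [Set.mem_ofPred_eq] at hL ⊢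
    rwa [hL]

theorem forall_sub_eq_iff {n : ℕ} {f g : Fin (n + 1) → ℤ} (h0 : f 0 = g 0) :
    (∀ i : Fin n, f i.succ - f i.castSucc = g i.succ - g i.castSucc) ↔
      ∀ i : Fin n, f i.succ = g i.succ := by
  refine ⟨fun h => ?_, fun h i => ?_⟩
  · have : ∀ j, f j = g j := fun j => by
      induction j using Fin.induction with
      | zero => exact h0
      | succ i ih => linarith [h i]
    exact fun i => this _
  · have : f i.castSucc = g i.castSucc := by
      obtain ⟨j, hj⟩ : ∃ j, j = i.castSucc := ⟨_, rfl⟩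
      rw [← hj]
      refine Fin.cases h0 h j
    rw [h i, this]

theorem height_succ (t : ℝ) (a : ℕ → ℝ) (n : ℕ) (ω : Sample) (i : Fin n) :
    (height t a (i + 1) n ω : ℤ) - height t a i n ω = pathString t a n ω i := by
  rw [height, height, Finset.range_add_one, Finset.filter_insert, pathString]
  split_ifs with h
  · rw [Finset.card_insert_of_notMem (by simp)]
    push_cast
    ring
  · simp

end HalfSpace

theorem theorem4p4 (t : ℝ) (ht : t ∈ Set.Ico (0 : ℝ) 1) (a : ℕ → ℝ)
    (ha : ∀ i, a i ∈ Set.Ioo (0 : ℝ) 1) (n : ℕ) :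
    (∀ L : Fin n → YoungDiagram, 0 ≤ HalfSpace.weightHL t a L) ∧
    IsProbabilityMeasure (HalfSpace.PHL t a n) ∧
    (∀ s : Fin n → ℤ,
      HalfSpace.PHL t a n {L | HalfSpace.support L = s} =
        HalfSpace.sampleMeasure {ω | HalfSpace.pathString t a n ω = s}) ∧
    (∀ k : Fin n → ℕ,
      HalfSpace.PHL t a n {L | ∀ i, HalfSpace.len (L i) = k i} =
        HalfSpace.sampleMeasure {ω | ∀ i : Fin n, HalfSpace.height t a (i + 1) n ω = k i}) := by
  open HalfSpace in
  refine ⟨fun L => ?_, ⟨PHL_univ ht ha n⟩, PHL_support_eq_pathString ht ha, fun k => ?_⟩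
  · rw [weightHL_eq ht fun i => (ha i).1]
    exact div_nonneg (chainWeight_nonneg ht (fun i => (ha i).1) _ _) (Phi_pos ht ha n).le
  · -- Prescribing the partial sums is the same as prescribing the increments.
    let g : Fin (n + 1) → ℤ := Fin.cons 0 fun i => (k i : ℤ)
    have h1 : {L : Fin n → YoungDiagram | ∀ i, len (L i) = k i} =
        {L | support L = fun i => g i.succ - g i.castSucc} := by
      ext L
      have := forall_sub_eq_iff (f := fun j => (len (HalfSpace.extend L j) : ℤ)) (g := g)
        (by simp [HalfSpace.extend, g, len_bot])
      rw [Set.mem_ofPred_eq, Set.mem_ofPred_eq, funext_iff]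
      refine Iff.trans ?_ this.symm
      simp [HalfSpace.extend, g]
    have h2 : {ω : Sample | ∀ i : Fin n, height t a (i + 1) n ω = k i} =
        {ω | pathString t a n ω = fun i => g i.succ - g i.castSucc} := by
      ext ω
      have := forall_sub_eq_iff (f := fun j => (height t a j n ω : ℤ)) (g := g)
        (by simp [height, g])
      rw [Set.mem_ofPred_eq, Set.mem_ofPred_eq, funext_iff]
      simp only [← height_succ]
      refine Iff.trans ?_ this.symm
      simp [g]
    rw [h1, h2, PHL_support_eq_pathString ht ha]
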